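/- Fix a topological space $Z$ and a subset $Y\subset Z$. **The category.** A *preimage problem* over $(Z,Y)$ is a continuous map $f:X\to Z$. Let $\mathcal P(Z,Y)$ be the category whose objects are the pairs $(X,f)$ and whose morphisms $(X,f)\to(U,g)$ are the continuous maps $k:X\to U$ with $gk=f$, and let $\mathbf{Ab}_*$ be the category of abelian groups graded by $p=0,1,2,\dots$. **The groups.** Let $C=f^{-1}(Y)$. A *singular $p$-manifold* in a space $A$ is a continuous map $s:S\to A$ from a closed (compact, without boundary, possibly empty or disconnected) oriented smooth $p$-manifold $S$. Singular $p$-manifolds $s_0:S_0\to C$ and $s_1:S_1\to C$ are *Nielsen equivalent* if there is an oriented bordism $W$ between $S_0$ and $S_1$ (a compact oriented smooth $(p+1)$-manifold with $\partial W=S_0\sqcup -S_1$), a map $H:W\to X$ extending $s_0\sqcup s_1$ and a map $G:W\to Y$ extending $fs_0\sqcup fs_1$ such that $fH$ and $G$ are homotopic, as maps to $Z$, relative to $S_0\sqcup S_1$. * $S'_p(f)$ is the set of Nielsen equivalence classes of singular $p$-manifolds in $C$, an abelian group under disjoint union. If $gk=f$, there is a homomorphism $k'_*:S'_p(f)\to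 S'_p(g)$, $[s]\mapsto[k\circ s]$. * The *Nielsen group* $S_p(f)\subset S'_p(f)$ consists of the classes preserved by all homotopies of $f$: $z\in S_p(f)$ if and only if, for every homotopy $F:[0,1]\times X\to Z$ with $F_0=f$, the element $(i_0)'_*z$ of $S'_p(F)$ lies in the image of $(i_1)'_*:S'_p(F_1)\to S'_p(F)$, where $i_t:X\to[0,1]\times X$ is $i_t(x)=(t,x)$ and $F_t=F\circ i_t$. * $S^a_p(f)=S'_p(f)/\ker I_f$, where $I_f:S'_p(f)\to\Omega_p(Y)$, $[s]\mapsto[f\circ s]$, is the index with values in the oriented bordism group of $Y$. **Corollary.** (a) $S'_*$, $S_*$ and $S^a_*$ are functors from $\mathcal P(Z,Y)$ to $\mathbf{Ab}_*$. On a morphism $k:(X,f)\to(U,g)$ the functor $S'_*$ is given by $k'_*[s]=[k\circ s]$; the homomorphism $k_*:S_*(f)\to S_*(g)$ is the restriction of $k'_*$ to $S_*(f)$; and $k^a_*:S^a_*(f)\to S^a_*(g)$ is the homomorphism that $k'_*$ induces on the quotients. (b) If $k:(X,f)\to(U,g)$ is a morphism of $\mathcal P(Z,Y)$ such that $k:X\to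 U$ is a homotopy equivalence, then $k_*:S_*(f)\to S_*(g)$ is an isomorphism. -/

import Mathlib

/-! Oriented smooth manifolds, oriented bordism, and the Nielsen bordism groups of a preimage
problem `f : X → Z ⊃ Y`. -/

open scoped Manifold ContDiff Topology

namespace HigherNielsen

/-- The derivative of `φ` at `x`, read in the preferred charts at `x` and at `φ x`. -/
noncomputable def chartDeriv {E E' H H' : Type*} [NormedAddCommGroup E] [NormedSpace ℝ E]
    [NormedAddCommGroup E'] [NormedSpace ℝ E'] [TopologicalSpace H] [TopologicalSpace H']
    (I : ModelWithCorners ℝ E H) (J : ModelWithCorners ℝ E' H')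
    {M N : Type*} [TopologicalSpace M] [ChartedSpace H M] [TopologicalSpace N] [ChartedSpace H' N]
    (φ : M → N) (x : M) : E →L[ℝ] E' :=
  mfderiv I J φ x

theorem chartDeriv_comp {E E' E'' H H' H'' : Type*} [NormedAddCommGroup E] [NormedSpace ℝ E]
    [NormedAddCommGroup E'] [NormedSpace ℝ E'] [NormedAddCommGroup E''] [NormedSpace ℝ E'']
    [TopologicalSpace H] [TopologicalSpace H'] [TopologicalSpace H'']
    {I : ModelWithCorners ℝ E H} {J : ModelWithCorners ℝ E' H'} {L : ModelWithCorners ℝ E'' H''}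
    {M N P : Type*} [TopologicalSpace M] [ChartedSpace H M] [TopologicalSpace N] [ChartedSpace H' N]
    [TopologicalSpace P] [ChartedSpace H'' P] {f : M → N} {g : N → P} {x : M}
    (hg : MDifferentiableAt J L g (f x)) (hf : MDifferentiableAt I J f x) :
    chartDeriv I L (g ∘ f) x = (chartDeriv J L g (f x)).comp (chartDeriv I J f x) :=
  mfderiv_comp x hg hf

/-- An orientation of the manifold `M` (with or without boundary, of any dimension including `0`),
recorded by signs: the preferred chart at `x` followed by the standard orientation of the model
vector space orients `T_x M`, and `σ x` says whether the chosen orientation at `x` agrees with that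
one. The choices have to fit together: near `x` the chart at `x`, corrected by `σ x`, is an
oriented chart. -/
def IsOrientation {E H : Type*} [NormedAddCommGroup E] [NormedSpace ℝ E] [TopologicalSpace H]
    (I : ModelWithCorners ℝ E H) {M : Type*} [TopologicalSpace M] [ChartedSpace H M]
    (σ : M → ℤˣ) : Prop :=
  ∀ x : M, ∀ᶠ y in 𝓝 x,
    0 < (((σ x * σ y : ℤˣ) : ℤ) : ℝ) * 
      (chartDeriv I 𝓘(ℝ, E) (extChartAt I x) y).det

/-- A compact oriented smooth Hausdorff manifold modelled on `I`. -/
structure CompactOrientedManifold {E H : Type} [NormedAddCommGroup E] [NormedSpace ℝ E]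
    [TopologicalSpace H] (I : ModelWithCorners ℝ E H) : Type 1 where
  carrier : Type
  [top : TopologicalSpace carrier]
  [charted : ChartedSpace H carrier]
  [smooth : IsManifold I ∞ carrier]
  [compact : CompactSpace carrier]
  [hausdorff : T2Space carrier]
  orientation : carrier → ℤˣ
  isOrientation : IsOrientation I orientation

namespace CompactOrientedManifold
variable {E H : Type} [NormedAddCommGroup E] [NormedSpace ℝ E]
    [TopologicalSpace H] {I : ModelWithCorners ℝ E H}

instance : CoeSort (CompactOrientedManifold I) Type := ⟨carrier⟩

attribute [instance] top charted smooth compact hausdorff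

/-- `M` with the opposite orientation. -/
noncomputable def neg (M : CompactOrientedManifold I) : CompactOrientedManifold I where
  carrier := M
  orientation x := - M.orientation x
  isOrientation x := by
    filter_upwards [M.isOrientation x] with y hy
    simpa using hy

/-- The empty manifold. -/
noncomputable def empty : CompactOrientedManifold I where
  carrier := Empty
  charted := ChartedSpace.empty H Empty
  smooth := by
    let _ : ChartedSpace H Empty := ChartedSpace.empty H Empty
    infer_instance
  orientation x := x.elim
  isOrientation x := x.elim

/-- The disjoint union. -/
noncomputable def sum (M N : CompactOrientedManifold I) : CompactOrientedManifold I where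
  carrier := M ⊕ N
  orientation := Sum.elim M.orientation N.orientation
  isOrientation := by
    have h1 : ∀ (x y : M), y ∈ (chartAt H x).source → 
       chartDeriv I 𝓘(ℝ, E) (extChartAt I (Sum.inl x : M ⊕ N)) (Sum.inl y) = chartDeriv I 𝓘(ℝ, E) (extChartAt I x) y := by
      intro x y hy
      have hd : MDifferentiableAt I 𝓘(ℝ, E) (extChartAt I (Sum.inl x : M ⊕ N)) (Sum.inl y : M ⊕ N) := by
        apply mdifferentiableAt_extChartAt
        simpa [ChartedSpace.sum_chartAt_inl] using hy
      have h2 := mfderiv_comp (I := I) (I' := I) (I'' := 𝓘(ℝ, E)) y hd (hasMFDerivAt_inl (M' := N) (I := I) (p := Sum.inl y) (q := y)).mdifferentiableAt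
      have h3 : (extChartAt I (Sum.inl x : M ⊕ N)) ∘ Sum.inl = extChartAt I x := by
        ext z; simp
      rw [h3, mfderiv_sumInl (p := Sum.inl y)] at h2
      rw [chartDeriv, chartDeriv, h2]; rfl
    have h1' : ∀ (x y : N), y ∈ (chartAt H x).source → 
       chartDeriv I 𝓘(ℝ, E) (extChartAt I (Sum.inr x : M ⊕ N)) (Sum.inr y) = chartDeriv I 𝓘(ℝ, E) (extChartAt I x) y := by
      intro x y hy
      have hd : MDifferentiableAt I 𝓘(ℝ, E) (extChartAt I (Sum.inr x : M ⊕ N)) (Sum.inr y : M ⊕ N) := by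
        apply mdifferentiableAt_extChartAt
        simpa [ChartedSpace.sum_chartAt_inr] using hy
      have h2 := mfderiv_comp (I := I) (I' := I) (I'' := 𝓘(ℝ, E)) y hd (hasMFDerivAt_inr (M := M) (I := I) (p := Sum.inr y) (q' := y)).mdifferentiableAt
      have h3 : (extChartAt I (Sum.inr x : M ⊕ N)) ∘ Sum.inr = extChartAt I x := by
        ext z; simp
      rw [h3, mfderiv_sumInr (q' := y)] at h2
      rw [chartDeriv, chartDeriv, h2]; rfl
    rintro (x | x)
    · rw [nhds_inl, Filter.eventually_map]
      filter_upwards [M.isOrientation x, chart_source_mem_nhds H x] with y hy hs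
      rw [h1 x y hs]
      exact hy
    · rw [nhds_inr, Filter.eventually_map]
      filter_upwards [N.isOrientation x, chart_source_mem_nhds H x] with y hy hs
      rw [h1' x y hs]
      exact hy
end CompactOrientedManifold

section tools
variable {E E' H H' H'' K K' : Type*} [NormedAddCommGroup E] [NormedSpace ℝ E]
  [NormedAddCommGroup E'] [NormedSpace ℝ E']
  [TopologicalSpace H] [TopologicalSpace H'] [TopologicalSpace H'']
  [TopologicalSpace K] [TopologicalSpace K']
  {I : ModelWithCorners ℝ E H} {J : ModelWithCorners ℝ E H'} {L : ModelWithCorners ℝ E H''}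
  {I' : ModelWithCorners ℝ E' K} {J' : ModelWithCorners ℝ E' K'}
  {M N P : Type*} [TopologicalSpace M] [ChartedSpace H M]
  [TopologicalSpace N] [ChartedSpace H' N] [TopologicalSpace P] [ChartedSpace H'' P]
  {M' N' : Type*} [TopologicalSpace M'] [ChartedSpace K M']
  [TopologicalSpace N'] [ChartedSpace K' N']

variable (I J) in
/-- `φ` is a smooth local diffeomorphism at `x` that carries the orientation `σ` at `x` to the
orientation `τ` at `φ x`. -/
def OrientedLocalDiffeoAt (σ : M → ℤˣ) (τ : N → ℤˣ) (φ : M → N) (x : M) : Prop :=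
  IsLocalDiffeomorphAt I J ∞ φ x ∧
    0 < (((σ x * τ (φ x) : ℤˣ) : ℤ) : ℝ) * (chartDeriv I J φ x).det

theorem infty_ne_zero' : (∞ : WithTop ℕ∞) ≠ 0 := by simp

theorem OrientedLocalDiffeoAt.comp {σ : M → ℤˣ} {τ : N → ℤˣ} {υ : P → ℤˣ} {f : M → N} {g : N → P}
    {x : M} (hg : OrientedLocalDiffeoAt J L τ υ g (f x)) (hf : OrientedLocalDiffeoAt I J σ τ f x) :
    OrientedLocalDiffeoAt I L σ υ (g ∘ f) x := by
  refine ⟨hf.1.comp _ _ hg.1, ?_⟩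
  have hm : mfderiv I L (g ∘ f) x = (mfderiv J L g (f x)).comp (mfderiv I J f x) :=
    mfderiv_comp x (hg.1.mdifferentiableAt infty_ne_zero') (hf.1.mdifferentiableAt infty_ne_zero')
  have hd : (chartDeriv I L (g ∘ f) x).det =
     (chartDeriv J L g (f x)).det * (chartDeriv I J f x).det := by
    rw [chartDeriv, hm]; exact LinearMap.det_comp _ _
  rw [hd]
  have := mul_pos hf.2 hg.2
  have h1 : (((τ (f x) : ℤ)) : ℝ) * ((τ (f x) : ℤ) : ℝ) = 1 := by
    norm_cast; rw [Int.units_mul_self]; simp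
  push_cast at this ⊢
  simp only [Function.comp]
  linear_combination this + ((((σ x : ℤ) : ℝ)) * ((υ (g (f x)) : ℤ) : ℝ) *
     (chartDeriv J L g (f x)).det * (chartDeriv I J f x).det) * h1

theorem OrientedLocalDiffeoAt.of_comp {σ : M → ℤˣ} {τ : N → ℤˣ} {υ : P → ℤˣ} {f : M → N} {g : N → P}
    {x : M} (hf : OrientedLocalDiffeoAt I J σ τ f x)
    (hgf : OrientedLocalDiffeoAt I L σ υ (g ∘ f) x) :
    OrientedLocalDiffeoAt J L τ υ g (f x) := by
  have hl : IsLocalDiffeomorphAt J L ∞ g (f x) := by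
    obtain ⟨Ψ, hx, heq⟩ := hgf.1
    have hlx : hf.1.localInverse (f x) = x := hf.1.localInverse_left_inv hf.1.localInverse_mem_target
    refine ⟨hf.1.localInverse.trans Ψ, ⟨hf.1.localInverse_mem_source, ?_⟩, ?_⟩
    · change hf.1.localInverse (f x) ∈ Ψ.source
      rw [hlx]; exact hx
    · rintro y ⟨hy1, hy2⟩
      have h1 := heq hy2
      have h2 : f (hf.1.localInverse y) = y := hf.1.localInverse_right_inv hy1
      change g y = Ψ (hf.1.localInverse y)
      refine Eq.trans ?_ h1
      exact (congrArg g h2).symm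
  refine ⟨hl, ?_⟩
  have hm : mfderiv I L (g ∘ f) x = (mfderiv J L g (f x)).comp (mfderiv I J f x) :=
    mfderiv_comp x (hl.mdifferentiableAt infty_ne_zero') (hf.1.mdifferentiableAt infty_ne_zero')
  have hd : (chartDeriv I L (g ∘ f) x).det =
     (chartDeriv J L g (f x)).det * (chartDeriv I J f x).det := by
    rw [chartDeriv, hm]; exact LinearMap.det_comp _ _
  have h2 := hgf.2
  rw [hd] at h2
  have := mul_pos hf.2 h2
  have h1 : (((σ x : ℤ)) : ℝ) * ((σ x : ℤ) : ℝ) = 1 := by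
    norm_cast; rw [Int.units_mul_self]; simp
  push_cast at this ⊢
  simp only [Function.comp] at this
  have h3 : 0 < (((τ (f x) : ℤ) : ℝ) * ((υ (g (f x)) : ℤ) : ℝ) *
     (chartDeriv J L g (f x)).det) * ((chartDeriv I J f x).det) ^ 2 := by
    linear_combination this + (((τ (f x) : ℤ) : ℝ) * ((υ (g (f x)) : ℤ) : ℝ) *
     (chartDeriv J L g (f x)).det) * ((chartDeriv I J f x).det) ^ 2 * h1
  exact pos_of_mul_pos_left h3 (sq_nonneg _)

theorem OrientedLocalDiffeoAt.congr_orientation {σ σ' : M → ℤˣ} {τ τ' : N → ℤˣ} {f : M → N} {x : M}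
    (hf : OrientedLocalDiffeoAt I J σ τ f x) (h : σ x * τ (f x) = σ' x * τ' (f x)) :
    OrientedLocalDiffeoAt I J σ' τ' f x := by
  refine ⟨hf.1, ?_⟩
  rw [← h]; exact hf.2

theorem OrientedLocalDiffeoAt.id (σ : M → ℤˣ) (x : M) :
    OrientedLocalDiffeoAt I I σ σ (fun y => y) x := by
  refine ⟨(Diffeomorph.refl I M ∞).isLocalDiffeomorph x, ?_⟩
  have h : mfderiv I I (fun y : M => y) x = ContinuousLinearMap.id ℝ (TangentSpace I x) := mfderiv_id
  have hd : (chartDeriv I I (fun y : M => y) x).det = 1 := by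
    rw [chartDeriv, h]; exact LinearMap.det_id
  rw [hd]
  simp

theorem OrientedLocalDiffeoAt.prodMap [FiniteDimensional ℝ E] [FiniteDimensional ℝ E']
    {σ : M → ℤˣ} {τ : N → ℤˣ} {σ' : M' → ℤˣ} {τ' : N' → ℤˣ}
    {f : M → N} {g : M' → N'} {x : M × M'}
    (hf : OrientedLocalDiffeoAt I J σ τ f x.1) (hg : OrientedLocalDiffeoAt I' J' σ' τ' g x.2) :
    OrientedLocalDiffeoAt (I.prod I') (J.prod J') (fun z : M × M' => σ z.1 * σ' z.2)
      (fun z : N × N' => τ z.1 * τ' z.2) (Prod.map f g) x := by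
  have hl : IsLocalDiffeomorphAt (I.prod I') (J.prod J') ∞ (Prod.map f g) x := by
    obtain ⟨Φ, hx, he⟩ := hf.1
    obtain ⟨Ψ, hy, he'⟩ := hg.1
    refine ⟨{ toPartialEquiv := Φ.toPartialEquiv.prod Ψ.toPartialEquiv
              open_source := Φ.open_source.prod Ψ.open_source
              open_target := Φ.open_target.prod Ψ.open_target
              contMDiffOn_toFun := Φ.contMDiffOn_toFun.prodMap Ψ.contMDiffOn_toFun
              contMDiffOn_invFun := Φ.contMDiffOn_invFun.prodMap Ψ.contMDiffOn_invFun },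
            ⟨hx, hy⟩, ?_⟩
    rintro ⟨a, b⟩ ⟨ha, hb⟩
    exact Prod.ext (he ha) (he' hb)
  refine ⟨hl, ?_⟩
  have hm := mfderiv_prodMap (p := x) (hf.1.mdifferentiableAt infty_ne_zero')
    (hg.1.mdifferentiableAt infty_ne_zero')
  have hd : (chartDeriv (I.prod I') (J.prod J') (Prod.map f g) x).det =
     (chartDeriv I J f x.1).det * (chartDeriv I' J' g x.2).det := by
    rw [chartDeriv, hm]; exact LinearMap.det_prodMap _ _
  rw [hd]
  have := mul_pos hf.2 hg.2
  push_cast at this ⊢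
  simp only [Prod.map]
  linear_combination this

variable {M₂ : Type*} [TopologicalSpace M₂] [ChartedSpace H M₂]

theorem OrientedLocalDiffeoAt.inl (σ : M → ℤˣ) (τ : M₂ → ℤˣ) (x : M) :
    OrientedLocalDiffeoAt I I σ (Sum.elim σ τ) (Sum.inl : M → M ⊕ M₂) x := by
  refine ⟨⟨{ toFun := Sum.inl, invFun := Sum.elim _root_.id (fun _ => x), source := Set.univ,
             target := Set.range Sum.inl, map_source' := by simp, map_target' := by simp,
             left_inv' := by simp, right_inv' := by rintro _ ⟨a, rfl⟩; rfl,
             open_source := isOpen_univ, open_target := isOpen_range_inl,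
             contMDiffOn_toFun := ContMDiff.inl.contMDiffOn,
             contMDiffOn_invFun := (contMDiff_id.sumElim contMDiff_const).contMDiffOn },
            Set.mem_univ _, fun _ _ => rfl⟩, ?_⟩
  have hd : (chartDeriv I I (Sum.inl : M → M ⊕ M₂) x).det = 1 := by
    rw [chartDeriv, mfderiv_sumInl (p := (Sum.inl x : M ⊕ M₂))]; exact LinearMap.det_id
  rw [hd]
  simp

theorem OrientedLocalDiffeoAt.inr (σ : M → ℤˣ) (τ : M₂ → ℤˣ) (x : M₂) :
    OrientedLocalDiffeoAt I I τ (Sum.elim σ τ) (Sum.inr : M₂ → M ⊕ M₂) x := by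
  refine ⟨⟨{ toFun := Sum.inr, invFun := Sum.elim (fun _ => x) _root_.id, source := Set.univ,
             target := Set.range Sum.inr, map_source' := by simp, map_target' := by simp,
             left_inv' := by simp, right_inv' := by rintro _ ⟨a, rfl⟩; rfl,
             open_source := isOpen_univ, open_target := isOpen_range_inr,
             contMDiffOn_toFun := ContMDiff.inr.contMDiffOn,
             contMDiffOn_invFun := (contMDiff_const.sumElim contMDiff_id).contMDiffOn },
            Set.mem_univ _, fun _ _ => rfl⟩, ?_⟩
  have hd : (chartDeriv I I (Sum.inr : M₂ → M ⊕ M₂) x).det = 1 := by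
    rw [chartDeriv, mfderiv_sumInr]; exact LinearMap.det_id
  rw [hd]
  simp
end tools

section interval
open Set WithLp

/-- The standard orientation of `[0,1]`; the preferred chart at `1` is `t ↦ 1 - t`, which reverses
it. -/
noncomputable def intervalOrientation (t : Icc (0 : ℝ) 1) : ℤˣ := if (t : ℝ) < 1 then 1 else -1

theorem det_fin_one (A : EuclideanSpace ℝ (Fin 1) →L[ℝ] EuclideanSpace ℝ (Fin 1)) :
    A.det = A (EuclideanSpace.single 0 1) 0 := by
  have := LinearMap.det_toMatrix (EuclideanSpace.basisFun (Fin 1) ℝ).toBasis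
    (A : EuclideanSpace ℝ (Fin 1) →ₗ[ℝ] EuclideanSpace ℝ (Fin 1))
  rw [ContinuousLinearMap.det, ← this, Matrix.det_unique, LinearMap.toMatrix_apply]
  simp

/-- The coordinate of the one-dimensional Euclidean space. -/
noncomputable def coordOne : EuclideanSpace ℝ (Fin 1) →L[ℝ] ℝ := EuclideanSpace.proj 0

theorem mfderiv_coord {E H M : Type*} [NormedAddCommGroup E] [NormedSpace ℝ E] [TopologicalSpace H]
    {I : ModelWithCorners ℝ E H} [TopologicalSpace M] [ChartedSpace H M]
    {φ : M → EuclideanSpace ℝ (Fin 1)} {x : M}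
    (h : MDifferentiableAt I 𝓘(ℝ, EuclideanSpace ℝ (Fin 1)) φ x) (v : E) :
    (chartDeriv I 𝓘(ℝ, ℝ) (fun y => φ y 0) x) v =
      (chartDeriv I 𝓘(ℝ, EuclideanSpace ℝ (Fin 1)) φ x) v 0 := by
  have h1 := (coordOne.hasFDerivAt (x := φ x)).hasMFDerivAt
  have h2 := chartDeriv_comp h1.mdifferentiableAt h
  have h3 : chartDeriv 𝓘(ℝ, EuclideanSpace ℝ (Fin 1)) 𝓘(ℝ, ℝ) coordOne (φ x) = coordOne := h1.mfderiv
  rw [h3] at h2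
  exact congrArg (fun A : E →L[ℝ] ℝ => A v) h2

theorem chartDeriv_extChartAt_self {E H M : Type*} [NormedAddCommGroup E] [NormedSpace ℝ E]
    [TopologicalSpace H] {I : ModelWithCorners ℝ E H} [TopologicalSpace M] [ChartedSpace H M]
    [IsManifold I 1 M] (x : M) :
    chartDeriv I 𝓘(ℝ, E) (extChartAt I x) x = ContinuousLinearMap.id ℝ E :=
  mfderiv_extChartAt_self

theorem coe_mdiff (s : Icc (0 : ℝ) 1) :
    MDifferentiableAt (𝓡∂ 1) 𝓘(ℝ, ℝ) (fun t : Icc (0 : ℝ) 1 => (t : ℝ)) s :=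
  (contMDiff_subtypeVal_Icc (n := 1) s).mdifferentiableAt one_ne_zero

theorem mfderiv_intervalChart {t s : Icc (0 : ℝ) 1}
    (hs : s ∈ (chartAt (EuclideanHalfSpace 1) t).source) (v : EuclideanSpace ℝ (Fin 1)) :
    (chartDeriv (𝓡∂ 1) 𝓘(ℝ, EuclideanSpace ℝ (Fin 1)) (extChartAt (𝓡∂ 1) t) s) v 0 =
    ((intervalOrientation t : ℤ) : ℝ) *
      (chartDeriv (𝓡∂ 1) 𝓘(ℝ, ℝ) (fun t : Icc (0 : ℝ) 1 => (t : ℝ)) s) v := by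
  rw [← mfderiv_coord (mdifferentiableAt_extChartAt hs)]
  by_cases ht : (t : ℝ) < 1
  · have : (fun y => extChartAt (𝓡∂ 1) t y 0) = fun t : Icc (0 : ℝ) 1 => (t : ℝ) := by
      ext y
      simp [extChartAt, ht, IccLeftChart]
    rw [this]
    simp [intervalOrientation, ht]
  · have : (fun y => extChartAt (𝓡∂ 1) t y 0) =
        (fun r : ℝ => 1 - r) ∘ fun t : Icc (0 : ℝ) 1 => (t : ℝ) := by
      ext y
      simp [extChartAt, ht, IccRightChart]
    rw [this]
    have h1 : HasMFDerivAt 𝓘(ℝ, ℝ) 𝓘(ℝ, ℝ) (fun r : ℝ => 1 - r) (s : ℝ)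
        (-(ContinuousLinearMap.id ℝ ℝ)) :=
      ((hasFDerivAt_id (𝕜 := ℝ) (s : ℝ)).const_sub 1).hasMFDerivAt
    have h2 : chartDeriv 𝓘(ℝ, ℝ) 𝓘(ℝ, ℝ) (fun r : ℝ => 1 - r) (s : ℝ) =
      -(ContinuousLinearMap.id ℝ ℝ) := h1.mfderiv
    rw [chartDeriv_comp h1.mdifferentiableAt (coe_mdiff s), h2]
    simp [intervalOrientation, ht]

theorem mfderiv_intervalCoe (s : Icc (0 : ℝ) 1) (v : EuclideanSpace ℝ (Fin 1)) :
    (chartDeriv (𝓡∂ 1) 𝓘(ℝ, ℝ) (fun t : Icc (0 : ℝ) 1 => (t : ℝ)) s) v = ((intervalOrientation s : ℤ) : ℝ) * v 0 := by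
  have h := mfderiv_intervalChart (mem_chart_source (EuclideanHalfSpace 1) s) v
  rw [chartDeriv_extChartAt_self] at h
  have h1 : (((intervalOrientation s : ℤ)) : ℝ) * ((intervalOrientation s : ℤ) : ℝ) = 1 := by
    norm_cast; rw [Int.units_mul_self]; simp
  change v 0 = _ at h
  rw [h, ← mul_assoc, h1, one_mul]

theorem isOrientation_interval : IsOrientation (𝓡∂ 1) intervalOrientation := by
  intro t
  filter_upwards [chart_source_mem_nhds (EuclideanHalfSpace 1) t] with s hs
  rw [det_fin_one, mfderiv_intervalChart hs, mfderiv_intervalCoe]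
  have h1 (s) : (((intervalOrientation s : ℤ)) : ℝ) * ((intervalOrientation s : ℤ) : ℝ) = 1 := by
    norm_cast; rw [Int.units_mul_self]; simp
  have h2 := h1 s
  have h3 := h1 t
  push_cast
  refine lt_of_lt_of_eq one_pos ?_
  simp only [PiLp.single_apply, if_true]
  linear_combination -h3 - ((intervalOrientation t : ℤ) : ℝ) ^ 2 * h2

theorem IsOrientation.prod {E E' H K M N : Type*} [NormedAddCommGroup E] [NormedSpace ℝ E]
    [NormedAddCommGroup E'] [NormedSpace ℝ E'] [FiniteDimensional ℝ E] [FiniteDimensional ℝ E']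
    [TopologicalSpace H] [TopologicalSpace K]
    {I : ModelWithCorners ℝ E H} {J : ModelWithCorners ℝ E' K}
    [TopologicalSpace M] [ChartedSpace H M] [TopologicalSpace N] [ChartedSpace K N]
    [IsManifold I 1 M] [IsManifold J 1 N]
    {σ : M → ℤˣ} {τ : N → ℤˣ} (hσ : IsOrientation I σ) (hτ : IsOrientation J τ) :
    IsOrientation (I.prod J) (fun z : M × N => σ z.1 * τ z.2) := by
  rintro ⟨x, y⟩
  have h1 := (hσ x).and (chart_source_mem_nhds H x)
  have h2 := (hτ y).and (chart_source_mem_nhds K y)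
  rw [nhds_prod_eq]
  filter_upwards [h1.prod_mk h2] with ⟨x', y'⟩ ⟨⟨h1, h1'⟩, h2, h2'⟩
  have hm := mfderiv_prodMap (p := (x', y')) (mdifferentiableAt_extChartAt (I := I) h1')
    (mdifferentiableAt_extChartAt (I := J) h2')
  have he : (extChartAt (I.prod J) (x, y) : M × N → E × E') =
      Prod.map (extChartAt I x) (extChartAt J y) := by
    rw [extChartAt_prod]; rfl
  have hd : (chartDeriv (I.prod J) 𝓘(ℝ, E × E') (extChartAt (I.prod J) (x, y)) (x', y')).det =
     (chartDeriv I 𝓘(ℝ, E) (extChartAt I x) x').det *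
      (chartDeriv J 𝓘(ℝ, E') (extChartAt J y) y').det := by
    rw [he, chartDeriv, modelWithCornersSelf_prod, ← chartedSpaceSelf_prod, hm]; exact LinearMap.det_prodMap _ _
  rw [hd]
  have := mul_pos h1 h2
  push_cast at this ⊢
  linear_combination this

/-- The embedding `x ↦ x / (2 (1 + x))` of `[0,∞)` onto `[0,1/2)`. -/
noncomputable def collarParam (x : EuclideanHalfSpace 1) : Icc (0 : ℝ) 1 :=
  ⟨x.1 0 / (2 * (1 + x.1 0)), by
    have := x.2
    constructor
    · positivity
    · rw [div_le_one (by positivity)]; linarith⟩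

theorem collarParam_lt (x : EuclideanHalfSpace 1) : (collarParam x : ℝ) < 1 / 2 := by
  have := x.2
  change x.1 0 / (2 * (1 + x.1 0)) < 1 / 2
  rw [div_lt_div_iff₀ (by positivity) (by positivity)]; linarith

/-- The inverse of `collarParam`. -/
noncomputable def collarParamInv (t : Icc (0 : ℝ) 1) : EuclideanHalfSpace 1 :=
  (𝓡∂ 1).symm (toLp 2 fun _ => 2 * (t : ℝ) / (1 - 2 * t))

theorem collarParamInv_coe {t : Icc (0 : ℝ) 1} (h : (t : ℝ) < 1 / 2) :
    (collarParamInv t).1 0 = 2 * (t : ℝ) / (1 - 2 * t) := by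
  have := t.2.1
  simp only [collarParamInv, modelWithCornersEuclideanHalfSpace_symm_apply]
  simp
  apply div_nonneg
  · linarith
  · linarith

theorem halfSpace_ext {x y : EuclideanHalfSpace 1} (h : x.1 0 = y.1 0) : x = y := by
  apply Subtype.ext
  ext i
  rw [Subsingleton.elim i 0]
  exact h

theorem collarParamInv_left (x : EuclideanHalfSpace 1) : collarParamInv (collarParam x) = x := by
  apply halfSpace_ext
  rw [collarParamInv_coe (collarParam_lt x)]
  have := x.2
  have h0 : 0 < 1 + x.1 0 := by linarith
  change 2 * (x.1 0 / (2 * (1 + x.1 0))) / (1 - 2 * (x.1 0 / (2 * (1 + x.1 0)))) = x.1 0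
  have h1 : (1 - 2 * (x.1 0 / (2 * (1 + x.1 0)))) = 1 / (1 + x.1 0) := by
    field_simp; ring
  rw [h1]
  field_simp

theorem collarParamInv_right {t : Icc (0 : ℝ) 1} (h : (t : ℝ) < 1 / 2) :
    collarParam (collarParamInv t) = t := by
  apply Subtype.ext
  change (collarParamInv t).1 0 / (2 * (1 + (collarParamInv t).1 0)) = t
  rw [collarParamInv_coe h]
  have h0 : 0 < 1 - 2 * (t : ℝ) := by linarith
  have h1 : 1 + 2 * (t : ℝ) / (1 - 2 * t) = 1 / (1 - 2 * t) := by field_simp; ring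
  rw [h1]
  field_simp

theorem contMDiff_halfSpaceCoord :
    ContMDiff (𝓡∂ 1) 𝓘(ℝ, ℝ) ∞ (fun x : EuclideanHalfSpace 1 => x.1 0) :=
  coordOne.contDiff.contMDiff.comp
    (ModelWithCorners.contMDiff (𝓡∂ 1))

theorem contMDiff_collarParam : ContMDiff (𝓡∂ 1) (𝓡∂ 1) ∞ collarParam := by
  have h : ContMDiff (𝓡∂ 1) 𝓘(ℝ, ℝ) ∞ ((fun t : Icc (0 : ℝ) 1 => (t : ℝ)) ∘ collarParam) := by
    intro x
    have := x.2
    have h1 : ContDiffAt ℝ ∞ (fun r : ℝ => r / (2 * (1 + r))) (x.1 0) := by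
      apply ContDiffAt.div (by fun_prop) (by fun_prop)
      positivity
    exact ContMDiffAt.comp (g := fun r : ℝ => r / (2 * (1 + r))) x h1.contMDiffAt
      (contMDiff_halfSpaceCoord x)
  refine contMDiff_iff_comp_subtypeVal_Icc.2 ⟨?_, h⟩
  exact h.continuous.subtype_mk _

theorem contMDiffOn_collarParamInv :
    ContMDiffOn (𝓡∂ 1) (𝓡∂ 1) ∞ collarParamInv {t : Icc (0 : ℝ) 1 | (t : ℝ) < 1 / 2} := by
  have h1 : ContMDiffOn (𝓡∂ 1) 𝓘(ℝ, EuclideanSpace ℝ (Fin 1)) ∞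
      (fun t : Icc (0 : ℝ) 1 =>
        (toLp 2 fun _ => 2 * (t : ℝ) / (1 - 2 * t) : EuclideanSpace ℝ (Fin 1)))
      {t : Icc (0 : ℝ) 1 | (t : ℝ) < 1 / 2} := by
    have h2 : ContDiffOn ℝ ∞ (fun r : ℝ =>
        (toLp 2 fun _ => 2 * r / (1 - 2 * r) : EuclideanSpace ℝ (Fin 1))) {r | r < 1 / 2} := by
      rw [contDiffOn_euclidean]
      intro i
      apply ContDiffOn.div (by fun_prop) (by fun_prop)
      intro r hr
      simp at hr
      intro h; linarith
    exact h2.contMDiffOn.comp contMDiff_subtypeVal_Icc.contMDiffOn (fun t ht => ht)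
  refine (ModelWithCorners.contMDiffOn_symm (𝓡∂ 1)).comp h1 ?_
  intro t ht
  rw [range_modelWithCornersEuclideanHalfSpace]
  have := t.2.1
  simp at ht
  simp
  apply div_nonneg <;> linarith

theorem collarParam_oriented (x : EuclideanHalfSpace 1) :
    OrientedLocalDiffeoAt (𝓡∂ 1) (𝓡∂ 1) (fun _ => 1) intervalOrientation collarParam x := by
  refine ⟨⟨{ toFun := collarParam, invFun := collarParamInv, source := univ,
             target := {t : Icc (0 : ℝ) 1 | (t : ℝ) < 1 / 2},
             map_source' := fun x _ => collarParam_lt x, map_target' := fun _ _ => mem_univ _,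
             left_inv' := fun x _ => collarParamInv_left x,
             right_inv' := fun t ht => collarParamInv_right ht,
             open_source := isOpen_univ,
             open_target := isOpen_lt continuous_subtype_val continuous_const,
             contMDiffOn_toFun := contMDiff_collarParam.contMDiffOn,
             contMDiffOn_invFun := contMDiffOn_collarParamInv }, mem_univ _, fun _ _ => rfl⟩, ?_⟩
  have hc : MDifferentiableAt (𝓡∂ 1) (𝓡∂ 1) collarParam x :=
    (contMDiff_collarParam x).mdifferentiableAt (by simp)
  have h1 := chartDeriv_comp (coe_mdiff (collarParam x)) hc
  have hx := x.2
  have h2 : HasDerivAt (fun r : ℝ => r / (2 * (1 + r))) (1 / (2 * (1 + x.1 0) ^ 2)) (x.1 0) := by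
    have := (hasDerivAt_id (x.1 0)).div (((hasDerivAt_id (x.1 0)).const_add 1).const_mul 2)
      (by simp; positivity)
    convert! this using 1
    simp
    field_simp
    ring
  have hI : MDifferentiableAt (𝓡∂ 1) 𝓘(ℝ, EuclideanSpace ℝ (Fin 1)) (extChartAt (𝓡∂ 1) x) x :=
    mdifferentiableAt_extChartAt (mem_chart_source _ x)
  have h3 : MDifferentiableAt (𝓡∂ 1) 𝓘(ℝ, ℝ) (fun y : EuclideanHalfSpace 1 => y.1 0) x :=
    (contMDiff_halfSpaceCoord x).mdifferentiableAt (by simp)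
  have h2' := h2.hasFDerivAt.hasMFDerivAt
  have h4 := chartDeriv_comp (f := fun y : EuclideanHalfSpace 1 => y.1 0) h2'.mdifferentiableAt h3
  have h2'' : chartDeriv 𝓘(ℝ, ℝ) 𝓘(ℝ, ℝ) (fun r : ℝ => r / (2 * (1 + r))) (x.1 0) = _ := h2'.mfderiv
  have h5 : (fun r : ℝ => r / (2 * (1 + r))) ∘ (fun y : EuclideanHalfSpace 1 => y.1 0) =
    (fun t : Icc (0 : ℝ) 1 => (t : ℝ)) ∘ collarParam := rfl
  rw [h5, h1, h2''] at h4
  have h6 := congrArg (fun A : EuclideanSpace ℝ (Fin 1) →L[ℝ] ℝ => A (EuclideanSpace.single 0 1)) h4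
  have h7 := mfderiv_coord hI (EuclideanSpace.single 0 1)
  rw [chartDeriv_extChartAt_self] at h7
  have h7' : chartDeriv (𝓡∂ 1) 𝓘(ℝ, ℝ) (fun y : EuclideanHalfSpace 1 => y.1 0) x
    (EuclideanSpace.single 0 1) = 1 := h7.trans (by simp)
  have h8 := mfderiv_intervalCoe (collarParam x) ((chartDeriv (𝓡∂ 1) (𝓡∂ 1) collarParam x)
    (EuclideanSpace.single 0 1))
  rw [det_fin_one, one_mul, ← h8]
  refine lt_of_lt_of_eq ?_ h6.symm
  simp only [ContinuousLinearMap.comp_apply]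
  rw [h7']
  simp
  positivity

theorem contMDiff_intervalSymm : ContMDiff (𝓡∂ 1) (𝓡∂ 1) ∞ (unitInterval.symm) := by
  refine contMDiff_iff_comp_subtypeVal_Icc.2 ⟨unitInterval.continuous_symm, ?_⟩
  have h1 : ContDiff ℝ ∞ (fun r : ℝ => 1 - r) := by fun_prop
  exact h1.contMDiff.comp contMDiff_subtypeVal_Icc

theorem intervalSymm_oriented (t : Icc (0 : ℝ) 1) :
    OrientedLocalDiffeoAt (𝓡∂ 1) (𝓡∂ 1) intervalOrientation (fun t => - intervalOrientation t)
      unitInterval.symm t := by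
  refine ⟨({ toEquiv := ⟨unitInterval.symm, unitInterval.symm, unitInterval.symm_symm,
                unitInterval.symm_symm⟩
             contMDiff_toFun := contMDiff_intervalSymm
             contMDiff_invFun := contMDiff_intervalSymm } :
             Diffeomorph (𝓡∂ 1) (𝓡∂ 1) (Icc (0 : ℝ) 1) (Icc (0 : ℝ) 1) ∞).isLocalDiffeomorph t, ?_⟩
  have hc : MDifferentiableAt (𝓡∂ 1) (𝓡∂ 1) unitInterval.symm t :=
    (contMDiff_intervalSymm t).mdifferentiableAt (by simp)
  have h1 := chartDeriv_comp (coe_mdiff (unitInterval.symm t)) hc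
  have h2 : HasMFDerivAt 𝓘(ℝ, ℝ) 𝓘(ℝ, ℝ) (fun r : ℝ => 1 - r) (t : ℝ)
        (-(ContinuousLinearMap.id ℝ ℝ)) :=
      ((hasFDerivAt_id (𝕜 := ℝ) (t : ℝ)).const_sub 1).hasMFDerivAt
  have h3 := chartDeriv_comp h2.mdifferentiableAt (coe_mdiff t)
  have h2' : chartDeriv 𝓘(ℝ, ℝ) 𝓘(ℝ, ℝ) (fun r : ℝ => 1 - r) (t : ℝ) =
      -(ContinuousLinearMap.id ℝ ℝ) := h2.mfderiv
  have h5 : (fun r : ℝ => 1 - r) ∘ (fun y : Icc (0 : ℝ) 1 => (y : ℝ)) =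
    (fun t : Icc (0 : ℝ) 1 => (t : ℝ)) ∘ unitInterval.symm := rfl
  rw [h5, h1, h2'] at h3
  have h6 := congrArg (fun A : EuclideanSpace ℝ (Fin 1) →L[ℝ] ℝ => A (EuclideanSpace.single 0 1)) h3
  have h8 := mfderiv_intervalCoe (unitInterval.symm t)
    ((chartDeriv (𝓡∂ 1) (𝓡∂ 1) unitInterval.symm t) (EuclideanSpace.single 0 1))
  have h9 := mfderiv_intervalCoe t (EuclideanSpace.single 0 1)
  have h10 : ((intervalOrientation (unitInterval.symm t) : ℤ) : ℝ) *
      (chartDeriv (𝓡∂ 1) (𝓡∂ 1) unitInterval.symm t).det =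
     - ((intervalOrientation t : ℤ) : ℝ) := by
    rw [det_fin_one, ← h8]
    refine h6.trans ?_
    change - (chartDeriv (𝓡∂ 1) 𝓘(ℝ, ℝ) (fun t : Icc (0 : ℝ) 1 => (t : ℝ)) t
        (EuclideanSpace.single 0 1)) = _
    rw [h9]; simp
  have h11 : (((intervalOrientation t : ℤ)) : ℝ) * ((intervalOrientation t : ℤ) : ℝ) = 1 := by
    norm_cast; rw [Int.units_mul_self]; simp
  push_cast
  refine lt_of_lt_of_eq (one_pos) ?_
  linear_combination - h11 + (-((intervalOrientation t : ℤ) : ℝ)) * (-1 : ℝ) * h10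
end interval


/-- An oriented bordism from `N₀` to `N₁`: a compact oriented smooth `(p+1)`-manifold `W` with
boundary (modelled on `ℝ^p × [0,∞)`), with an identification of the oriented manifold `∂W` with the
disjoint union of `N₀` and of `N₁` with the opposite orientation.

The identification is given as a collar `(N₀ ⊔ N₁) × [0,∞) → W`, an injective orientation
preserving local diffeomorphism whose restriction to `(N₀ ⊔ N₁) × {0}` is the identification with
`∂W`; every diffeomorphism of `N₀ ⊔ N₁` with `∂W` extends to such a collar by the collar
neighbourhood theorem. `∂W` is oriented by the rule that a basis of its tangent space is positive
when the basis followed by an inward normal vector is positive in `W`; another convention only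
changes the orientation of `W`. -/
structure Bordism {p : ℕ} (N₀ N₁ : CompactOrientedManifold (𝓡 p))
    extends CompactOrientedManifold ((𝓡 p).prod (𝓡∂ 1)) where
  collar₀ : N₀ × EuclideanHalfSpace 1 → carrier
  collar₁ : N₁ × EuclideanHalfSpace 1 → carrier
  oriented₀ : ∀ z, OrientedLocalDiffeoAt ((𝓡 p).prod (𝓡∂ 1)) ((𝓡 p).prod (𝓡∂ 1))
    (fun z : N₀ × EuclideanHalfSpace 1 => N₀.orientation z.1) orientation collar₀ z
  oriented₁ : ∀ z, OrientedLocalDiffeoAt ((𝓡 p).prod (𝓡∂ 1)) ((𝓡 p).prod (𝓡∂ 1))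
    (fun z : N₁ × EuclideanHalfSpace 1 => - N₁.orientation z.1) orientation collar₁ z
  injective : Function.Injective (Sum.elim collar₀ collar₁)
  boundary_eq : ((𝓡 p).prod (𝓡∂ 1)).boundary carrier =
    Set.range (fun x => collar₀ (x, 0)) ∪ Set.range (fun x => collar₁ (x, 0))

namespace Bordism
variable {p : ℕ} {N₀ N₁ N₀' N₁' : CompactOrientedManifold (𝓡 p)}

/-- The identification of `N₀` with a part of `∂W`. -/
def end₀ (W : Bordism N₀ N₁) (x : N₀) : W.carrier := W.collar₀ (x, 0)

/-- The identification of `N₁` with a part of `∂W`. -/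
def end₁ (W : Bordism N₀ N₁) (x : N₁) : W.carrier := W.collar₁ (x, 0)

theorem end₀_mem (W : Bordism N₀ N₁) (x : N₀) :
    W.end₀ x ∈ ((𝓡 p).prod (𝓡∂ 1)).boundary W.carrier := by
  rw [W.boundary_eq]; exact Or.inl ⟨x, rfl⟩

theorem end₁_mem (W : Bordism N₀ N₁) (x : N₁) :
    W.end₁ x ∈ ((𝓡 p).prod (𝓡∂ 1)).boundary W.carrier := by
  rw [W.boundary_eq]; exact Or.inr ⟨x, rfl⟩

/-- `W` with the opposite orientation. -/
noncomputable def neg (W : Bordism N₀ N₁) : Bordism N₀.neg N₁.neg where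
  toCompactOrientedManifold := W.toCompactOrientedManifold.neg
  collar₀ := W.collar₀
  collar₁ := W.collar₁
  oriented₀ z := (W.oriented₀ z).congr_orientation (by simp [CompactOrientedManifold.neg])
  oriented₁ z := (W.oriented₁ z).congr_orientation (by simp [CompactOrientedManifold.neg])
  injective := W.injective
  boundary_eq := W.boundary_eq

/-- The disjoint union of two collars. -/
def sumCollar {A B K V V' : Type*} (c : A × K → V) (c' : B × K → V') (z : (A ⊕ B) × K) : V ⊕ V' :=
  match z with
  | (Sum.inl a, t) => Sum.inl (c (a, t))
  | (Sum.inr b, t) => Sum.inr (c' (b, t))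

theorem sumCollar_injective {A B A' B' K V V' : Type*} {c : A × K → V} {c₁ : A' × K → V}
    {c' : B × K → V'} {c₁' : B' × K → V'} (h : Function.Injective (Sum.elim c c₁))
    (h' : Function.Injective (Sum.elim c' c₁')) :
    Function.Injective (Sum.elim (sumCollar c c') (sumCollar c₁ c₁')) := by
  rintro (⟨a | a, t⟩ | ⟨a | a, t⟩) (⟨b | b, s⟩ | ⟨b | b, s⟩) hab <;>
    simp only [Sum.elim_inl, Sum.elim_inr, sumCollar, Sum.inl.injEq, Sum.inr.injEq,
      reduceCtorEq] at hab
  · have := @h (Sum.inl (a, t)) (Sum.inl (b, s)) hab; simp_all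
  · have := @h (Sum.inl (a, t)) (Sum.inr (b, s)) hab; simp_all
  · have := @h' (Sum.inl (a, t)) (Sum.inl (b, s)) hab; simp_all
  · have := @h' (Sum.inl (a, t)) (Sum.inr (b, s)) hab; simp_all
  · have := @h (Sum.inr (a, t)) (Sum.inl (b, s)) hab; simp_all
  · have := @h (Sum.inr (a, t)) (Sum.inr (b, s)) hab; simp_all
  · have := @h' (Sum.inr (a, t)) (Sum.inl (b, s)) hab; simp_all
  · have := @h' (Sum.inr (a, t)) (Sum.inr (b, s)) hab; simp_all

theorem oriented_of_sum {E E' H H' K : Type*} [NormedAddCommGroup E] [NormedSpace ℝ E]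
    [NormedAddCommGroup E'] [NormedSpace ℝ E'] [FiniteDimensional ℝ E] [FiniteDimensional ℝ E']
    [TopologicalSpace H] [TopologicalSpace H'] [TopologicalSpace K]
    {I : ModelWithCorners ℝ E H} {J : ModelWithCorners ℝ E' K}
    {L : ModelWithCorners ℝ (E × E') H'}
    {A B C V : Type*} [TopologicalSpace A] [ChartedSpace H A] [TopologicalSpace B]
    [ChartedSpace H B] [TopologicalSpace C] [ChartedSpace K C] [TopologicalSpace V]
    [ChartedSpace H' V] {σ : A → ℤˣ} {τ : B → ℤˣ} {υ : V → ℤˣ} {c : (A ⊕ B) × C → V}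
    (hA : ∀ z, OrientedLocalDiffeoAt (I.prod J) L (fun z : A × C => σ z.1) υ
      (fun z : A × C => c (Sum.inl z.1, z.2)) z)
    (hB : ∀ z, OrientedLocalDiffeoAt (I.prod J) L (fun z : B × C => τ z.1) υ
      (fun z : B × C => c (Sum.inr z.1, z.2)) z) (z : (A ⊕ B) × C) :
    OrientedLocalDiffeoAt (I.prod J) L (fun z : (A ⊕ B) × C => Sum.elim σ τ z.1) υ c z := by
  obtain ⟨a | b, t⟩ := z
  · have h1 := (OrientedLocalDiffeoAt.inl (I := I) σ τ a).prodMap (x := (a, t))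
      (OrientedLocalDiffeoAt.id (I := J) (fun _ => 1) t)
    have h2 := h1.of_comp (g := c) (υ := υ) (L := L)
      ((hA (a, t)).congr_orientation (by simp))
    exact h2.congr_orientation (by simp)
  · have h1 := (OrientedLocalDiffeoAt.inr (I := I) σ τ b).prodMap (x := (b, t))
      (OrientedLocalDiffeoAt.id (I := J) (fun _ => 1) t)
    have h2 := h1.of_comp (g := c) (υ := υ) (L := L)
      ((hB (b, t)).congr_orientation (by simp))
    exact h2.congr_orientation (by simp)

/-- The disjoint union of two bordisms. -/
noncomputable def sum (W : Bordism N₀ N₁) (W' : Bordism N₀' N₁') :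
    Bordism (N₀.sum N₀') (N₁.sum N₁') where
  toCompactOrientedManifold := W.toCompactOrientedManifold.sum W'.toCompactOrientedManifold
  collar₀ := sumCollar W.collar₀ W'.collar₀
  collar₁ := sumCollar W.collar₁ W'.collar₁
  oriented₀ := oriented_of_sum
    (fun z => (OrientedLocalDiffeoAt.inl _ _ _).comp (W.oriented₀ z))
    (fun z => (OrientedLocalDiffeoAt.inr _ _ _).comp (W'.oriented₀ z))
  oriented₁ z := (oriented_of_sum (σ := fun x => - N₁.orientation x)
    (τ := fun x => - N₁'.orientation x) (υ := Sum.elim W.orientation W'.orientation)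
    (c := sumCollar W.collar₁ W'.collar₁)
    (fun z => (OrientedLocalDiffeoAt.inl _ _ _).comp (W.oriented₁ z))
    (fun z => (OrientedLocalDiffeoAt.inr _ _ _).comp (W'.oriented₁ z)) z).congr_orientation (by
      obtain ⟨a | b, t⟩ := z <;> rfl)
  injective := sumCollar_injective W.injective W'.injective
  boundary_eq := by
    refine (ModelWithCorners.boundary_disjointUnion).trans ?_
    rw [W.boundary_eq, W'.boundary_eq]
    ext w
    constructor
    · rintro (⟨_, ⟨x, rfl⟩ | ⟨x, rfl⟩, rfl⟩ | ⟨_, ⟨x, rfl⟩ | ⟨x, rfl⟩, rfl⟩)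
      · exact Or.inl ⟨Sum.inl x, rfl⟩
      · exact Or.inr ⟨Sum.inl x, rfl⟩
      · exact Or.inl ⟨Sum.inr x, rfl⟩
      · exact Or.inr ⟨Sum.inr x, rfl⟩
    · rintro (⟨x | x, rfl⟩ | ⟨x | x, rfl⟩)
      · exact Or.inl ⟨_, Or.inl ⟨x, rfl⟩, rfl⟩
      · exact Or.inr ⟨_, Or.inl ⟨x, rfl⟩, rfl⟩
      · exact Or.inl ⟨_, Or.inr ⟨x, rfl⟩, rfl⟩
      · exact Or.inr ⟨_, Or.inr ⟨x, rfl⟩, rfl⟩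

/-- The oriented manifold `N × [0,1]`. -/
noncomputable def cylinderManifold (N : CompactOrientedManifold (𝓡 p)) :
    CompactOrientedManifold ((𝓡 p).prod (𝓡∂ 1)) where
  carrier := N × Set.Icc (0 : ℝ) 1
  orientation z := N.orientation z.1 * intervalOrientation z.2
  isOrientation := by
    have : IsManifold (𝓡 p) 1 N := IsManifold.of_le (n := ∞) (by simp)
    exact N.isOrientation.prod isOrientation_interval

theorem collarParam_zero : collarParam 0 = 0 := by
  apply Subtype.ext
  change (0 : EuclideanSpace ℝ (Fin 1)) 0 / (2 * (1 + (0 : EuclideanSpace ℝ (Fin 1)) 0)) = 0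
  simp

theorem collarParam_injective : Function.Injective collarParam := fun a b h => by
  rw [← collarParamInv_left a, h, collarParamInv_left]

theorem collarParam_ne_symm (a b : EuclideanHalfSpace 1) :
    collarParam a ≠ unitInterval.symm (collarParam b) := by
  intro h
  have h1 := collarParam_lt a
  have h2 := collarParam_lt b
  have h3 : (collarParam a : ℝ) = 1 - collarParam b := congrArg Subtype.val h
  linarith

theorem cylinder_injective {A B : Type*} {d : A → B} (hd : Function.Injective d) :
    Function.Injective (Sum.elim
      (fun z : B × EuclideanHalfSpace 1 => (z.1, collarParam z.2))
      (fun z : A × EuclideanHalfSpace 1 => (d z.1, unitInterval.symm (collarParam z.2)))) := by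
  rintro (⟨a, t⟩ | ⟨a, t⟩) (⟨b, s⟩ | ⟨b, s⟩) hab <;>
    simp only [Sum.elim_inl, Sum.elim_inr, Prod.mk.injEq] at hab
  · rw [hab.1, collarParam_injective hab.2]
  · exact (collarParam_ne_symm _ _ hab.2).elim
  · exact (collarParam_ne_symm _ _ hab.2.symm).elim
  · rw [hd hab.1, collarParam_injective (unitInterval.symm_bijective.1 hab.2)]

/-- The cylinder `N₀ × [0,1]` as a bordism from `N₀` to `N₁`, for an orientation preserving
diffeomorphism `d : N₁ → N₀`. -/
noncomputable def cylinder (N₀ N₁ : CompactOrientedManifold (𝓡 p)) (d : N₁ → N₀)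
    (hd : Function.Bijective d)
    (h : ∀ x, OrientedLocalDiffeoAt (𝓡 p) (𝓡 p) N₁.orientation N₀.orientation d x) :
    Bordism N₀ N₁ where
  toCompactOrientedManifold := cylinderManifold N₀
  collar₀ z := (z.1, collarParam z.2)
  collar₁ z := (d z.1, unitInterval.symm (collarParam z.2))
  oriented₀ z := ((OrientedLocalDiffeoAt.id N₀.orientation z.1).prodMap
    (collarParam_oriented z.2)).congr_orientation (by simp [cylinderManifold])
  oriented₁ z := ((h z.1).prodMap ((intervalSymm_oriented _).comp
    (collarParam_oriented z.2))).congr_orientation (by simp [cylinderManifold])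
  injective := cylinder_injective hd.1
  boundary_eq := by
    refine (boundary_product (𝓡 p)).trans ?_
    ext ⟨n, t⟩
    constructor
    · rintro ⟨-, rfl | rfl⟩
      · exact Or.inl ⟨n, Prod.ext rfl collarParam_zero⟩
      · obtain ⟨m, rfl⟩ := hd.2 n
        refine Or.inr ⟨m, Prod.ext rfl ?_⟩
        simp only [collarParam_zero, unitInterval.symm_zero]; rfl
    · rintro (⟨x, h⟩ | ⟨x, h⟩)
      · refine ⟨trivial, Or.inl ?_⟩
        rw [← congrArg Prod.snd h]; exact collarParam_zero
      · refine ⟨trivial, Or.inr ?_⟩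
        rw [← congrArg Prod.snd h]
        simp only [collarParam_zero, unitInterval.symm_zero]; rfl

/-- Both ends of `N × [0,1]` as one collar. -/
noncomputable def bentCollar (N : Type*) (z : (N ⊕ N) × EuclideanHalfSpace 1) :
    N × Set.Icc (0 : ℝ) 1 :=
  match z with
  | (Sum.inl a, t) => (a, unitInterval.symm (collarParam t))
  | (Sum.inr a, t) => (a, collarParam t)

theorem bentCollar_injective (N : Type*) {f : Empty × EuclideanHalfSpace 1 → N × Set.Icc (0 : ℝ) 1} :
    Function.Injective (Sum.elim (bentCollar N) f) := by
  rintro (⟨a | a, t⟩ | ⟨a, t⟩) (⟨b | b, s⟩ | ⟨b, s⟩) hab <;> (try exact a.elim) <;>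
    (try exact b.elim) <;>
    simp only [Sum.elim_inl, bentCollar, Prod.mk.injEq] at hab
  · rw [hab.1, collarParam_injective (unitInterval.symm_bijective.1 hab.2)]
  · exact (collarParam_ne_symm _ _ hab.2.symm).elim
  · exact (collarParam_ne_symm _ _ hab.2).elim
  · rw [hab.1, collarParam_injective hab.2]

/-- The cylinder `N × [0,1]` as a bordism from `-N ⊔ N` to the empty manifold. -/
noncomputable def bentCylinder (N : CompactOrientedManifold (𝓡 p)) :
    Bordism (N.neg.sum N) CompactOrientedManifold.empty where
  toCompactOrientedManifold := cylinderManifold N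
  collar₀ := bentCollar N
  collar₁ z := z.1.elim
  oriented₀ := oriented_of_sum (c := bentCollar N)
    (fun z => ((OrientedLocalDiffeoAt.id N.orientation z.1).prodMap
      ((intervalSymm_oriented _).comp (collarParam_oriented z.2))).congr_orientation
        (by simp [cylinderManifold, CompactOrientedManifold.neg]))
    (fun z => ((OrientedLocalDiffeoAt.id N.orientation z.1).prodMap
      (collarParam_oriented z.2)).congr_orientation (by simp [cylinderManifold]))
  oriented₁ z := z.1.elim
  injective := bentCollar_injective N
  boundary_eq := by
    refine (boundary_product (𝓡 p)).trans ?_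
    ext ⟨n, t⟩
    constructor
    · rintro ⟨-, rfl | rfl⟩
      · exact Or.inl ⟨Sum.inr n, Prod.ext rfl collarParam_zero⟩
      · refine Or.inl ⟨Sum.inl n, Prod.ext rfl ?_⟩
        simp only [bentCollar, collarParam_zero, unitInterval.symm_zero]; rfl
    · rintro (⟨x | x, h⟩ | ⟨x, h⟩)
      · refine ⟨trivial, Or.inr ?_⟩
        rw [← congrArg Prod.snd h]
        simp only [bentCollar, collarParam_zero, unitInterval.symm_zero]; rfl
      · refine ⟨trivial, Or.inl ?_⟩
        rw [← congrArg Prod.snd h]; exact collarParam_zero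
      · exact x.elim
end Bordism

universe u v w

/-- A singular closed oriented smooth `p`-manifold in `A`: a closed oriented `p`-manifold with a
continuous map to `A`. The manifolds live in `Type`; every compact manifold is diffeomorphic to
one that does. -/
structure SingularClosedManifold (p : ℕ) (A : Type*) [TopologicalSpace A]
    extends CompactOrientedManifold (𝓡 p) where
  map : C(carrier, A)

namespace SingularClosedManifold
variable {p : ℕ} {A B : Type*} [TopologicalSpace A] [TopologicalSpace B]

/-- `[s] ↦ [e ∘ s]`. -/
def push (e : C(A, B)) (s : SingularClosedManifold p A) : SingularClosedManifold p B where
  toCompactOrientedManifold := s.toCompactOrientedManifold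
  map := e.comp s.map

/-- The opposite orientation. -/
noncomputable def neg (s : SingularClosedManifold p A) : SingularClosedManifold p A where
  toCompactOrientedManifold := s.toCompactOrientedManifold.neg
  map := s.map

/-- The disjoint union. -/
noncomputable def sum (s t : SingularClosedManifold p A) : SingularClosedManifold p A where
  toCompactOrientedManifold := s.toCompactOrientedManifold.sum t.toCompactOrientedManifold
  map := ⟨Sum.elim s.map t.map, s.map.continuous.sumElim t.map.continuous⟩

/-- The empty singular manifold. -/
noncomputable def empty : SingularClosedManifold p A where
  toCompactOrientedManifold := CompactOrientedManifold.empty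
  map := ⟨fun x : Empty => x.elim, continuous_iff_continuousAt.2 fun x : Empty => x.elim⟩

theorem push_sum (e : C(A, B)) (s t : SingularClosedManifold p A) :
    (s.sum t).push e = (s.push e).sum (t.push e) := by
  have : e.comp (s.sum t).map = ((s.push e).sum (t.push e)).map := by
    ext (x | x) <;> rfl
  unfold push sum at *
  simp only [SingularClosedManifold.mk.injEq, heq_eq_eq, true_and]
  exact this

theorem push_empty (e : C(A, B)) :
    (empty : SingularClosedManifold p A).push e = empty := by
  have : e.comp (empty : SingularClosedManifold p A).map =
      (empty : SingularClosedManifold p B).map := by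
    ext x; exact x.elim
  unfold push empty at *
  simp only [SingularClosedManifold.mk.injEq, heq_eq_eq, true_and]
  exact this

end SingularClosedManifold

/-- `s₀` and `s₁` are bordant in `A`. -/
def Bordant {p : ℕ} {A : Type*} [TopologicalSpace A] (s₀ s₁ : SingularClosedManifold p A) : Prop :=
  ∃ (W : Bordism s₀.toCompactOrientedManifold s₁.toCompactOrientedManifold) (h : C(W.carrier, A)),
    (∀ x, h (W.end₀ x) = s₀.map x) ∧ (∀ x, h (W.end₁ x) = s₁.map x)

/-- Four properties of a relation between singular manifolds which make the disjoint union a group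
structure on its classes (proved for bordism and for Nielsen equivalence below). -/
structure IsAdditiveRelation {p : ℕ} {A : Type*} [TopologicalSpace A]
    (r : SingularClosedManifold p A → SingularClosedManifold p A → Prop) : Prop where
  of_diffeo : ∀ (s t : SingularClosedManifold p A) (d : t.carrier → s.carrier), d.Bijective →
    (∀ x, OrientedLocalDiffeoAt (𝓡 p) (𝓡 p) t.orientation s.orientation d x) →
    (∀ x, s.map (d x) = t.map x) → r s t
  sum : ∀ {s s' t t' : SingularClosedManifold p A}, r s s' → r t t' → r (s.sum t) (s'.sum t')
  neg : ∀ {s s' : SingularClosedManifold p A}, r s s' → r s.neg s'.neg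
  neg_sum : ∀ s : SingularClosedManifold p A, r (s.neg.sum s) SingularClosedManifold.empty

namespace IsAdditiveRelation
variable {p : ℕ} {A B : Type*} [TopologicalSpace A] [TopologicalSpace B]

theorem bordant : IsAdditiveRelation (Bordant (p := p) (A := A)) where
  of_diffeo s t d hd hd' h := by
    refine ⟨Bordism.cylinder _ _ d hd hd', s.map.comp ⟨Prod.fst, continuous_fst⟩, fun x => rfl, h⟩
  sum := by
    rintro s s' t t' ⟨W, h, h₀, h₁⟩ ⟨W', h', h₀', h₁'⟩
    refine ⟨W.sum W', ⟨Sum.elim h h', h.continuous.sumElim h'.continuous⟩, ?_, ?_⟩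
    · rintro (x | x)
      · exact h₀ x
      · exact h₀' x
    · rintro (x | x)
      · exact h₁ x
      · exact h₁' x
  neg := by
    rintro s s' ⟨W, h, h₀, h₁⟩
    exact ⟨W.neg, h, h₀, h₁⟩
  neg_sum s := by
    refine ⟨Bordism.bentCylinder _, s.map.comp ⟨Prod.fst, continuous_fst⟩, ?_, fun x => x.elim⟩
    rintro (x | x) <;> rfl

theorem comap (e : C(A, B)) {r : SingularClosedManifold p B → SingularClosedManifold p B → Prop}
    (hr : IsAdditiveRelation r) : IsAdditiveRelation fun s t => r (s.push e) (t.push e) where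
  of_diffeo s t d hd hd' h := hr.of_diffeo _ _ d hd hd' fun x => congrArg e (h x)
  sum h h' := by
    rw [SingularClosedManifold.push_sum, SingularClosedManifold.push_sum]; exact hr.sum h h'
  neg h := hr.neg h
  neg_sum s := by
    rw [SingularClosedManifold.push_sum, SingularClosedManifold.push_empty]; exact hr.neg_sum (s.push e)

variable {r : SingularClosedManifold p A → SingularClosedManifold p A → Prop}

theorem refl (hr : IsAdditiveRelation r) (s : SingularClosedManifold p A) : r s s :=
  hr.of_diffeo s s (fun x => x) Function.bijective_id (OrientedLocalDiffeoAt.id _) fun _ => rfl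

theorem comm (hr : IsAdditiveRelation r) (s t : SingularClosedManifold p A) :
    r (s.sum t) (t.sum s) := by
  refine hr.of_diffeo _ _ (Sum.swap : t.carrier ⊕ s.carrier → s.carrier ⊕ t.carrier)
    (Equiv.sumComm _ _).bijective ?_ ?_
  · rintro (x | x)
    · exact (OrientedLocalDiffeoAt.inl t.orientation s.orientation x).of_comp
        (OrientedLocalDiffeoAt.inr s.orientation t.orientation x)
    · exact (OrientedLocalDiffeoAt.inr t.orientation s.orientation x).of_comp
        (OrientedLocalDiffeoAt.inl s.orientation t.orientation x)
  · rintro (x | x) <;> rfl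

theorem assoc (hr : IsAdditiveRelation r) (s t w : SingularClosedManifold p A) :
    r ((s.sum t).sum w) (s.sum (t.sum w)) := by
  refine hr.of_diffeo _ _ ((Equiv.sumAssoc s.carrier t.carrier w.carrier).symm)
    (Equiv.sumAssoc _ _ _).symm.bijective ?_ ?_
  · rintro (x | x | x)
    · exact (OrientedLocalDiffeoAt.inl s.orientation (t.sum w).orientation x).of_comp
        ((OrientedLocalDiffeoAt.inl (s.sum t).orientation w.orientation _).comp
          (OrientedLocalDiffeoAt.inl s.orientation t.orientation x))
    · exact ((OrientedLocalDiffeoAt.inr s.orientation (t.sum w).orientation _).comp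
          (OrientedLocalDiffeoAt.inl t.orientation w.orientation x)).of_comp
        ((OrientedLocalDiffeoAt.inl (s.sum t).orientation w.orientation _).comp
          (OrientedLocalDiffeoAt.inr s.orientation t.orientation x))
    · exact ((OrientedLocalDiffeoAt.inr s.orientation (t.sum w).orientation _).comp
          (OrientedLocalDiffeoAt.inr t.orientation w.orientation x)).of_comp
        (OrientedLocalDiffeoAt.inr (s.sum t).orientation w.orientation x)
  · rintro (x | x | x) <;> rfl

theorem empty_sum (hr : IsAdditiveRelation r) (s : SingularClosedManifold p A) :
    r (SingularClosedManifold.empty.sum s) s := by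
  refine hr.of_diffeo _ _ (Sum.inr : s.carrier → Empty ⊕ s.carrier)
    ⟨Sum.inr_injective, ?_⟩ ?_ fun _ => rfl
  · rintro (x | x)
    · exact x.elim
    · exact ⟨x, rfl⟩
  · exact fun x => OrientedLocalDiffeoAt.inr _ s.orientation x

/-- The group structure given by the disjoint union; the zero is the empty manifold and the
negative is the opposite orientation. -/
@[reducible]
noncomputable def addCommGroup (hr : IsAdditiveRelation r) : AddCommGroup (Quot r) :=
  letI : Add (Quot r) := ⟨Quot.map₂ SingularClosedManifold.sum (fun s _ _ h => hr.sum (hr.refl s) h)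
    (fun _ _ t h => hr.sum h (hr.refl t))⟩
  letI : Zero (Quot r) := ⟨Quot.mk r SingularClosedManifold.empty⟩
  letI : Neg (Quot r) := ⟨Quot.map SingularClosedManifold.neg fun _ _ h => hr.neg h⟩
  { add_assoc := by
      rintro ⟨a⟩ ⟨b⟩ ⟨c⟩; exact Quot.sound (hr.assoc a b c)
    zero_add := by rintro ⟨a⟩; exact Quot.sound (hr.empty_sum a)
    add_zero := by
      rintro ⟨a⟩
      exact (Quot.sound (hr.comm a SingularClosedManifold.empty)).trans
        (Quot.sound (hr.empty_sum a))
    nsmul := nsmulRec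
    zsmul := zsmulRec
    neg_add_cancel := by rintro ⟨a⟩; exact Quot.sound (hr.neg_sum a)
    add_comm := by rintro ⟨a⟩ ⟨b⟩; exact Quot.sound (hr.comm a b) }

end IsAdditiveRelation

/-- The oriented bordism group `Ω_p(A)`. (`Quot` is the quotient by the equivalence relation that
the relation generates; bordism is an equivalence relation.) -/
def BordismGroup (p : ℕ) (A : Type u) [TopologicalSpace A] : Type (max u 1) :=
  Quot (Bordant (p := p) (A := A))

noncomputable instance (p : ℕ) (A : Type u) [TopologicalSpace A] :
    AddCommGroup (BordismGroup p A) :=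
  IsAdditiveRelation.bordant.addCommGroup

section Nielsen
variable {X : Type u} {U : Type v} {Z : Type w} [TopologicalSpace X] [TopologicalSpace U]
  [TopologicalSpace Z] {p : ℕ}

/-- Nielsen equivalence of `s₀, s₁` in `C = f⁻¹(Y)`: there is a bordism `W` from `S₀` to `S₁` with an
extension `H : W → X` of `s₀ ⊔ s₁` and an extension `G : W → Y` of `f s₀ ⊔ f s₁` such that `f H` and
`G` are homotopic as maps to `Z` relative to the boundary `S₀ ⊔ S₁`. -/
def NielsenEquiv (f : C(X, Z)) (Y : Set Z) (s₀ s₁ : SingularClosedManifold p (f ⁻¹' Y)) : Prop :=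
  ∃ (W : Bordism s₀.toCompactOrientedManifold s₁.toCompactOrientedManifold)
    (H : C(W.carrier, X)) (G : C(W.carrier, Y)),
    (∀ x, H (W.end₀ x) = s₀.map x) ∧ (∀ x, H (W.end₁ x) = s₁.map x) ∧
    (∀ x, (G (W.end₀ x) : Z) = f (s₀.map x)) ∧ (∀ x, (G (W.end₁ x) : Z) = f (s₁.map x)) ∧
    (f.comp H).HomotopicRel ((ContinuousMap.mk Subtype.val).comp G)
      (((𝓡 p).prod (𝓡∂ 1)).boundary W.carrier)

/-- The triples of a point `x` of `X`, a path in `Z` and a point `y` of `Y` such that the path leads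
from `f x` to `y`. Nielsen equivalence is bordism in this space. -/
def HomotopyFiber (f : C(X, Z)) (Y : Set Z) : Type (max u w) :=
  {q : X × C(unitInterval, Z) × Y // q.2.1 0 = f q.1 ∧ q.2.1 1 = q.2.2}

instance (f : C(X, Z)) (Y : Set Z) : TopologicalSpace (HomotopyFiber f Y) :=
  inferInstanceAs (TopologicalSpace (Subtype _))

/-- `x ↦ (x, constant path, f x)`. -/
def toHomotopyFiber (f : C(X, Z)) (Y : Set Z) : C(f ⁻¹' Y, HomotopyFiber f Y) where
  toFun x := ⟨(x, ContinuousMap.const _ (f x), ⟨f x, x.2⟩), rfl, rfl⟩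
  continuous_toFun := by
    refine Continuous.subtype_mk (continuous_subtype_val.prodMk (Continuous.prodMk ?_ ?_)) _
    · exact ContinuousMap.continuous_const'.comp (f.continuous.comp continuous_subtype_val)
    · exact (f.continuous.comp continuous_subtype_val).subtype_mk _

theorem nielsenEquiv_iff (f : C(X, Z)) (Y : Set Z) (s₀ s₁ : SingularClosedManifold p (f ⁻¹' Y)) :
    NielsenEquiv f Y s₀ s₁ ↔
      Bordant (s₀.push (toHomotopyFiber f Y)) (s₁.push (toHomotopyFiber f Y)) := by
  constructor
  · rintro ⟨W, H, G, hH₀, hH₁, hG₀, hG₁, ⟨K⟩⟩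
    let γ : C(W.carrier, C(unitInterval, Z)) :=
      (K.toContinuousMap.comp ContinuousMap.prodSwap).curry
    have hγ : ∀ w, w ∈ ((𝓡 p).prod (𝓡∂ 1)).boundary W.carrier →
        γ w = ContinuousMap.const _ (f (H w)) := by
      intro w hw
      ext t
      exact K.eq_fst t hw
    refine ⟨W, ⟨fun w => ⟨(H w, γ w, G w), K.map_zero_left w, K.map_one_left w⟩, ?_⟩, ?_, ?_⟩
    · exact Continuous.subtype_mk
        (H.continuous.prodMk (γ.continuous.prodMk G.continuous)) _
    · intro x
      refine Subtype.ext (Prod.ext (hH₀ x) (Prod.ext ?_ (Subtype.ext (hG₀ x))))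
      refine (hγ _ (W.end₀_mem x)).trans ?_
      exact congrArg (fun y => ContinuousMap.const unitInterval (f y)) (hH₀ x)
    · intro x
      refine Subtype.ext (Prod.ext (hH₁ x) (Prod.ext ?_ (Subtype.ext (hG₁ x))))
      refine (hγ _ (W.end₁_mem x)).trans ?_
      exact congrArg (fun y => ContinuousMap.const unitInterval (f y)) (hH₁ x)
  · rintro ⟨W, h, h₀, h₁⟩
    have hc : Continuous fun w => (h w).1 := continuous_subtype_val.comp h.continuous
    have hγ : Continuous fun w => (h w).1.2.1 := (continuous_fst.comp continuous_snd).comp hc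
    refine ⟨W, ⟨fun w => (h w).1.1, continuous_fst.comp hc⟩,
      ⟨fun w => (h w).1.2.2, (continuous_snd.comp continuous_snd).comp hc⟩,
      fun x => congrArg (fun q => q.1.1) (h₀ x), fun x => congrArg (fun q => q.1.1) (h₁ x),
      fun x => congrArg (fun q => (q.1.2.2 : Z)) (h₀ x),
      fun x => congrArg (fun q => (q.1.2.2 : Z)) (h₁ x), ⟨?_⟩⟩
    refine
      { toFun := fun z => (h z.2).1.2.1 z.1
        continuous_toFun := ContinuousEval.continuous_eval.comp
          ((hγ.comp continuous_snd).prodMk continuous_fst)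
        map_zero_left := fun w => (h w).2.1
        map_one_left := fun w => (h w).2.2
        prop' := ?_ }
    intro t w hw
    rw [W.boundary_eq] at hw
    rcases hw with ⟨x, rfl⟩ | ⟨x, rfl⟩
    · change (h (W.end₀ x)).1.2.1 t = f (h (W.end₀ x)).1.1
      rw [h₀ x]; rfl
    · change (h (W.end₁ x)).1.2.1 t = f (h (W.end₁ x)).1.1
      rw [h₁ x]; rfl

theorem isAdditiveRelation_nielsenEquiv (f : C(X, Z)) (Y : Set Z) :
    IsAdditiveRelation (NielsenEquiv (p := p) f Y) := by
  have h := (IsAdditiveRelation.bordant (p := p)).comap (toHomotopyFiber f Y)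
  have he : NielsenEquiv (p := p) f Y = fun s t =>
      Bordant (s.push (toHomotopyFiber f Y)) (t.push (toHomotopyFiber f Y)) := by
    ext s t; exact nielsenEquiv_iff f Y s t
  rw [he]; exact h

/-- The group `S'_p(f, Y)` of Nielsen classes of singular closed oriented `p`-manifolds in `f⁻¹(Y)`.
(`Quot` is the quotient by the equivalence relation that the relation generates; Nielsen equivalence
is an equivalence relation.) -/
def PreNielsenGroup (f : C(X, Z)) (Y : Set Z) (p : ℕ) : Type (max u 1) :=
  Quot (NielsenEquiv (p := p) f Y)

noncomputable instance (f : C(X, Z)) (Y : Set Z) (p : ℕ) : AddCommGroup (PreNielsenGroup f Y p) :=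
  (isAdditiveRelation_nielsenEquiv f Y).addCommGroup

/-- The Nielsen class of a singular manifold. -/
def nielsenClass {f : C(X, Z)} {Y : Set Z} (s : SingularClosedManifold p (f ⁻¹' Y)) :
    PreNielsenGroup f Y p :=
  Quot.mk _ s

/-- The map `f⁻¹(Y) → g⁻¹(Y)` given by `k` with `g k = f`. -/
def preimageMap {f : C(X, Z)} {g : C(U, Z)} (k : C(X, U)) (hk : g.comp k = f) (Y : Set Z) :
    C(f ⁻¹' Y, g ⁻¹' Y) where
  toFun x := ⟨k x.1, (congrArg (· ∈ Y) (DFunLike.congr_fun hk x.1)).mpr x.2⟩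
  continuous_toFun := (k.continuous.comp continuous_subtype_val).subtype_mk _

/-- `k'_* : S'_p(f, Y) → S'_p(g, Y)`, `[s] ↦ [k s]`, for `g k = f`. -/
noncomputable def inducedHom {f : C(X, Z)} {g : C(U, Z)} (k : C(X, U)) (hk : g.comp k = f)
    (Y : Set Z) (p : ℕ) : PreNielsenGroup f Y p →+ PreNielsenGroup g Y p where
  toFun := Quot.map (SingularClosedManifold.push (preimageMap k hk Y)) (by
    subst hk
    rintro s t ⟨W, H, G, hH₀, hH₁, hG₀, hG₁, hK⟩
    exact ⟨W, k.comp H, G, fun x => congrArg k (hH₀ x), fun x => congrArg k (hH₁ x),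
      hG₀, hG₁, hK⟩)
  map_zero' := congrArg (Quot.mk _) (SingularClosedManifold.push_empty _)
  map_add' := by
    rintro ⟨s⟩ ⟨t⟩
    exact congrArg (Quot.mk _) (SingularClosedManifold.push_sum _ _ _)

/-- The inclusion `i_t : X → [0,1] × X`, `x ↦ (t, x)`. -/
def slice (X : Type u) [TopologicalSpace X] (t : unitInterval) : C(X, unitInterval × X) where
  toFun x := (t, x)

/-- The Nielsen group `S_p(f, Y)`, as a subgroup of `S'_p(f, Y)`: the intersection, over all
homotopies `F : [0,1] × X → Z` of `f`, of the groups of classes that are preserved by `F`, which are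
the classes `z` whose image `i_0'(z)` in `S'_p(F, Y)` lies in the image of
`i_1' : S'_p(F_1, Y) → S'_p(F, Y)`. -/
noncomputable def nielsenSubgroup (f : C(X, Z)) (Y : Set Z) (p : ℕ) :
    AddSubgroup (PreNielsenGroup f Y p) :=
  ⨅ (F : C(unitInterval × X, Z)) (hF : F.comp (slice X 0) = f),
    (inducedHom (slice X 1) rfl Y p : PreNielsenGroup (F.comp (slice X 1)) Y p →+
      PreNielsenGroup F Y p).range.comap (inducedHom (slice X 0) hF Y p)

/-- `f : f⁻¹(Y) → Y`. -/
def restrictToPreimage (f : C(X, Z)) (Y : Set Z) : C(f ⁻¹' Y, Y) where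
  toFun x := ⟨f x, x.2⟩
  continuous_toFun := (f.continuous.comp continuous_subtype_val).subtype_mk _

/-- The index `I_f : S'_p(f, Y) → Ω_p(Y)`, `[s] ↦ [f s]`. -/
noncomputable def bordismIndex (f : C(X, Z)) (Y : Set Z) (p : ℕ) :
    PreNielsenGroup f Y p →+ BordismGroup p Y where
  toFun := Quot.map (SingularClosedManifold.push (restrictToPreimage f Y)) (by
    rintro s t ⟨W, H, G, -, -, hG₀, hG₁, -⟩
    exact ⟨W, G, fun x => Subtype.ext (hG₀ x), fun x => Subtype.ext (hG₁ x)⟩)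
  map_zero' := congrArg (Quot.mk _) (SingularClosedManifold.push_empty _)
  map_add' := by
    rintro ⟨s⟩ ⟨t⟩
    exact congrArg (Quot.mk _) (SingularClosedManifold.push_sum _ _ _)

/-- `S^a_p(f, Y) = S'_p(f, Y) / ker I_f`. -/
abbrev AlgNielsenGroup (f : C(X, Z)) (Y : Set Z) (p : ℕ) : Type (max u 1) :=
  PreNielsenGroup f Y p ⧸ (bordismIndex f Y p).ker

end Nielsen


section Category
open CategoryTheory

/-- The map `f : X → Z` of an object of `Over Z`. For `Y ⊆ Z` the category of preimage problems
`P(Z, Y)` is `Over Z`: its objects are the maps `f : X → Z` and its morphisms from `f : X → Z` to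
`g : U → Z` are the maps `k : X → U` with `g k = f`. -/
abbrev problemMap {Z : TopCat.{u}} (P : Over Z) : C(P.left, Z) := P.hom.hom

/-- The map `k : X → U` of a morphism of preimage problems. -/
abbrev morphismMap {Z : TopCat.{u}} {P Q : Over Z} (k : P ⟶ Q) : C(P.left, Q.left) := k.left.hom

theorem problemMap_comp {Z : TopCat.{u}} {P Q : Over Z} (k : P ⟶ Q) :
    (problemMap Q).comp (morphismMap k) = problemMap P :=
  congrArg (fun φ : P.left ⟶ Z => φ.hom) (Over.w k)

/-- The graded abelian group `S'_*(f, Y)`. -/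
noncomputable def preNielsenObj {Z : TopCat.{u}} (Y : Set Z) (P : Over Z) :
    GradedObject ℕ AddCommGrpCat.{max u 1} :=
  fun p => AddCommGrpCat.of (PreNielsenGroup (problemMap P) Y p)

/-- The graded abelian group `S_*(f, Y)`. -/
noncomputable def nielsenObj {Z : TopCat.{u}} (Y : Set Z) (P : Over Z) :
    GradedObject ℕ AddCommGrpCat.{max u 1} :=
  fun p => AddCommGrpCat.of (nielsenSubgroup (problemMap P) Y p)

/-- The graded abelian group `S^a_*(f, Y)`. -/
noncomputable def algNielsenObj {Z : TopCat.{u}} (Y : Set Z) (P : Over Z) :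
    GradedObject ℕ AddCommGrpCat.{max u 1} :=
  fun p => AddCommGrpCat.of (AlgNielsenGroup (problemMap P) Y p)

/-- A functor with prescribed values on objects. -/
structure FunctorOn {C D : Type*} [Category* C] [Category* D] (F : C → D) where
  map : ∀ {P Q : C}, (P ⟶ Q) → (F P ⟶ F Q)
  map_id : ∀ P : C, map (𝟙 P) = 𝟙 (F P)
  map_comp : ∀ {P Q R : C} (k : P ⟶ Q) (l : Q ⟶ R), map (k ≫ l) = map k ≫ map l

/-- The functor as a Mathlib functor. -/
def FunctorOn.toFunctor {C D : Type*} [Category* C] [Category* D] {F : C → D} (S : FunctorOn F) :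
    C ⥤ D where
  obj := F
  map := S.map
  map_id := S.map_id
  map_comp := S.map_comp

end Category

end HigherNielsen

open CategoryTheory HigherNielsen
universe u

/-! A Nielsen equivalence is a bordism of singular manifolds in the homotopy fiber product of
`f` and `Y → Z`. Bordisms are composed by identifying the two collars `N × [0,1]` of the common end
`N` through the reversal `t ↦ 1 - t`: over `0 < t < 1` this is an oriented diffeomorphism of
interiors, so the glued space needs no smoothing, and maps that agree on `N` extend to it after the
collars have been collapsed. Hence equality in `S'_p(f)` means Nielsen equivalence of
representatives, which can be moved along maps of homotopy fibers. It follows that the inclusion of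
a strong deformation retract induces an injection on `S'_p`. Applied to the slices of `[0,1] × X`
and to the halves of that cylinder, this shows that a self-map over `Z` that is homotopic to the
identity as a map of spaces induces a bijection of `S_p`. For a homotopy equivalence `k` with
inverse `l` the maps `k ∘ l` and `l ∘ k` are of this kind, over the problems `g` and `g ∘ k`, and
two-out-of-six applies. -/

namespace HigherNielsen

section OrientedLocalDiffeo
variable {E H H' H'' : Type*} [NormedAddCommGroup E] [NormedSpace ℝ E]
  [TopologicalSpace H] [TopologicalSpace H'] [TopologicalSpace H'']
  {I : ModelWithCorners ℝ E H} {J : ModelWithCorners ℝ E H'} {L : ModelWithCorners ℝ E H''}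
  {M N P : Type*} [TopologicalSpace M] [ChartedSpace H M] [TopologicalSpace N] [ChartedSpace H' N]
  [TopologicalSpace P] [ChartedSpace H'' P]

/-- The restriction of a partial diffeomorphism to an open subset of its source. -/
noncomputable def restrictPartialDiffeomorph (Φ : PartialDiffeomorph I J M N ∞) {s : Set M}
    (hs : IsOpen s) : PartialDiffeomorph I J M N ∞ where
  toPartialEquiv := (Φ.toOpenPartialHomeomorph.restrOpen s hs).toPartialEquiv
  open_source := (Φ.toOpenPartialHomeomorph.restrOpen s hs).open_source
  open_target := (Φ.toOpenPartialHomeomorph.restrOpen s hs).open_target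
  contMDiffOn_toFun := Φ.contMDiffOn_toFun.mono Set.inter_subset_left
  contMDiffOn_invFun := Φ.contMDiffOn_invFun.mono Set.inter_subset_left

theorem isLocalDiffeomorphAt_congr_of_eventuallyEq {f g : M → N} {x : M}
    (hf : IsLocalDiffeomorphAt I J ∞ f x) (h : g =ᶠ[𝓝 x] f) : IsLocalDiffeomorphAt I J ∞ g x := by
  obtain ⟨Φ, hx, hΦ⟩ := hf
  obtain ⟨s, hs, hso, hxs⟩ := eventually_nhds_iff.1 h
  exact ⟨restrictPartialDiffeomorph Φ hso, ⟨hx, hxs⟩, fun y hy => (hs y hy.2).trans (hΦ hy.1)⟩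

theorem OrientedLocalDiffeoAt.congr_of_eventuallyEq {σ : M → ℤˣ} {τ : N → ℤˣ} {f g : M → N} {x : M}
    (hf : OrientedLocalDiffeoAt I J σ τ f x) (h : g =ᶠ[𝓝 x] f) :
    OrientedLocalDiffeoAt I J σ τ g x := by
  refine ⟨isLocalDiffeomorphAt_congr_of_eventuallyEq hf.1 h, ?_⟩
  rw [show chartDeriv I J g x = chartDeriv I J f x from h.mfderiv_eq, h.eq_of_nhds]
  exact hf.2

theorem OrientedLocalDiffeoAt.continuousAt {σ : M → ℤˣ} {τ : N → ℤˣ} {f : M → N} {x : M}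
    (hf : OrientedLocalDiffeoAt I J σ τ f x) : ContinuousAt f x :=
  hf.1.contMDiffAt.continuousAt

theorem OrientedLocalDiffeoAt.of_leftInverse {σ : M → ℤˣ} {τ : N → ℤˣ} {f : M → N} {g : N → M}
    {x : M} (hf : OrientedLocalDiffeoAt I J σ τ f x) (hg : ∀ᶠ y in 𝓝 x, g (f y) = y) :
    OrientedLocalDiffeoAt J I τ σ g (f x) :=
  hf.of_comp ((OrientedLocalDiffeoAt.id σ x).congr_of_eventuallyEq hg)

theorem OrientedLocalDiffeoAt.exists_comp_eventuallyEq {σ : M → ℤˣ} {τ : N → ℤˣ} {υ : P → ℤˣ}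
    {a : M → N} {b : M → P} {x : M} (ha : OrientedLocalDiffeoAt I J σ τ a x)
    (hb : OrientedLocalDiffeoAt I L σ υ b x) :
    ∃ g : N → P, OrientedLocalDiffeoAt J L τ υ g (a x) ∧ g ∘ a =ᶠ[𝓝 x] b := by
  have hga : (b ∘ ha.1.localInverse) ∘ a =ᶠ[𝓝 x] b :=
    ha.1.localInverse_eventuallyEq_left.fun_comp b
  exact ⟨b ∘ ha.1.localInverse, ha.of_comp (hb.congr_of_eventuallyEq hga), hga⟩

theorem isLocalDiffeomorphAt_of_chartAt_comp_eventuallyEq {N : Type*} [TopologicalSpace N]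
    [ChartedSpace H N] [IsManifold I ∞ M] [IsManifold I ∞ N] {f : M → N} {x : M}
    (hf : ContinuousAt f x) (hchart : chartAt H (f x) ∘ f =ᶠ[𝓝 x] chartAt H x) :
    IsLocalDiffeomorphAt I I ∞ f x := by
  let e := chartAt H x ≫ₕ (chartAt H (f x)).symm
  let Φ : PartialDiffeomorph I I M N ∞ :=
    { toPartialEquiv := e.toPartialEquiv
      open_source := e.open_source
      open_target := e.open_target
      contMDiffOn_toFun := (contMDiffOn_chart_symm (I := I) (x := f x)).comp
        (contMDiffOn_chart.mono Set.inter_subset_left) fun _ hy => hy.2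
      contMDiffOn_invFun := (contMDiffOn_chart_symm (I := I) (x := x)).comp
        (contMDiffOn_chart.mono Set.inter_subset_left) fun _ hy => hy.2 }
  have hΦ : IsLocalDiffeomorphAt I I ∞ Φ x := by
    refine Φ.isLocalDiffeomorphAt I I ∞ ⟨mem_chart_source H x, ?_⟩
    change chartAt H x x ∈ (chartAt H (f x)).target
    rw [← hchart.eq_of_nhds]
    exact (chartAt H (f x)).map_source (mem_chart_source H (f x))
  refine isLocalDiffeomorphAt_congr_of_eventuallyEq hΦ ?_
  filter_upwards [hchart, hf.eventually (chart_source_mem_nhds H (f x))] with y hy hys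
  change f y = (chartAt H (f x)).symm (chartAt H x y)
  rw [← hy, Function.comp_apply, (chartAt H (f x)).left_inv hys]

theorem OrientedLocalDiffeoAt.of_chartAt_comp_eventuallyEq {N : Type*} [TopologicalSpace N]
    [ChartedSpace H N] [IsManifold I ∞ M] [IsManifold I ∞ N] {σ : M → ℤˣ} {τ : N → ℤˣ} {f : M → N}
    {x : M} (hf : ContinuousAt f x) (hchart : chartAt H (f x) ∘ f =ᶠ[𝓝 x] chartAt H x)
    (hστ : σ x = τ (f x)) : OrientedLocalDiffeoAt I I σ τ f x := by
  have : IsManifold I 1 M := IsManifold.of_le (n := ∞) (by simp)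
  have : IsManifold I 1 N := IsManifold.of_le (n := ∞) (by simp)
  have hl := isLocalDiffeomorphAt_of_chartAt_comp_eventuallyEq (I := I) hf hchart
  refine ⟨hl, ?_⟩
  have hext : extChartAt I (f x) ∘ f =ᶠ[𝓝 x] extChartAt I x := hchart.fun_comp I
  have hderiv := chartDeriv_comp
    (mdifferentiableAt_extChartAt (I := I) (mem_chart_source H (f x)))
    (hl.mdifferentiableAt infty_ne_zero')
  rw [show chartDeriv I 𝓘(ℝ, E) (extChartAt I (f x) ∘ f) x = chartDeriv I 𝓘(ℝ, E) (extChartAt I x) x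
    from hext.mfderiv_eq, chartDeriv_extChartAt_self, chartDeriv_extChartAt_self,
    ContinuousLinearMap.id_comp] at hderiv
  have hdet : (ContinuousLinearMap.id ℝ E).det = 1 := LinearMap.det_id
  rw [← hderiv, hdet, hστ, Int.units_mul_self]
  norm_num

end OrientedLocalDiffeo

/-- `π` exhibits `Q` as a quotient of the open part `U` of the oriented manifold `V`: on `U` it is
a local homeomorphism onto `Q`, and two points of `U` with the same image are interchanged by the
germ of an oriented diffeomorphism over `Q`. The smooth structure and the orientation of `V` then
descend to `Q`, without any covering or group action being involved. -/
structure IsOrientedQuotient {E H V Q : Type*} [NormedAddCommGroup E] [NormedSpace ℝ E]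
    [TopologicalSpace H] (I : ModelWithCorners ℝ E H) [TopologicalSpace V] [ChartedSpace H V]
    [TopologicalSpace Q] (σ : V → ℤˣ) (π : V → Q) (U : Set V) : Prop where
  isOpen : IsOpen U
  isLocalHomeomorphOn : IsLocalHomeomorphOn π U
  surjOn : Set.SurjOn π U Set.univ
  exists_germ : ∀ v ∈ U, ∀ w ∈ U, π v = π w →
    ∃ g : V → V, OrientedLocalDiffeoAt I I σ σ g v ∧ g v = w ∧ π ∘ g =ᶠ[𝓝 v] π

namespace IsOrientedQuotient
variable {E H V Q : Type*} [NormedAddCommGroup E] [NormedSpace ℝ E]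
  [TopologicalSpace H] {I : ModelWithCorners ℝ E H} [TopologicalSpace V] [ChartedSpace H V]
  [TopologicalSpace Q] {σ : V → ℤˣ} {π : V → Q} {U : Set V} (h : IsOrientedQuotient I σ π U)
include h

/-- A chosen preimage of `q` in `U`. -/
noncomputable def rep (q : Q) : V := (h.surjOn (Set.mem_univ q)).choose

theorem rep_mem (q : Q) : h.rep q ∈ U := (h.surjOn (Set.mem_univ q)).choose_spec.1

theorem apply_rep (q : Q) : π (h.rep q) = q := (h.surjOn (Set.mem_univ q)).choose_spec.2

/-- The map `π`, restricted to a neighbourhood of `h.rep q` in `U` on which it is injective. -/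
noncomputable def param (q : Q) : OpenPartialHomeomorph V Q :=
  (h.isLocalHomeomorphOn (h.rep q) (h.rep_mem q)).choose.restrOpen U h.isOpen

theorem coe_param (q : Q) : ⇑(h.param q) = π :=
  (h.isLocalHomeomorphOn (h.rep q) (h.rep_mem q)).choose_spec.2.symm

theorem param_source_subset (q : Q) : (h.param q).source ⊆ U := Set.inter_subset_right

theorem rep_mem_param_source (q : Q) : h.rep q ∈ (h.param q).source :=
  ⟨(h.isLocalHomeomorphOn (h.rep q) (h.rep_mem q)).choose_spec.1, h.rep_mem q⟩

theorem mem_param_target (q : Q) : q ∈ (h.param q).target := by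
  have hq := (h.param q).map_source (h.rep_mem_param_source q)
  rwa [h.coe_param, h.apply_rep] at hq

theorem param_symm_self (q : Q) : (h.param q).symm q = h.rep q := by
  have hq := (h.param q).left_inv (h.rep_mem_param_source q)
  rwa [h.coe_param, h.apply_rep] at hq

theorem apply_param_symm {q y : Q} (hy : y ∈ (h.param q).target) : π ((h.param q).symm y) = y := by
  simpa only [h.coe_param] using (h.param q).right_inv hy

theorem param_symm_apply {q : Q} {v : V} (hv : v ∈ (h.param q).source) :
    (h.param q).symm (π v) = v := by
  simpa only [h.coe_param] using (h.param q).left_inv hv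

theorem oriented_param_symm_comp_param (q q' : Q) {v : V} (hv : v ∈ (h.param q).source)
    (hvq : h.param q v ∈ (h.param q').target) :
    OrientedLocalDiffeoAt I I σ σ ((h.param q').symm ∘ h.param q) v := by
  rw [h.coe_param] at hvq ⊢
  have hw := (h.param q').map_target hvq
  obtain ⟨g, hg, hgv, hπg⟩ := h.exists_germ v (h.param_source_subset q hv) _
    (h.param_source_subset q' hw) (h.apply_param_symm hvq).symm
  refine hg.congr_of_eventuallyEq ?_
  filter_upwards [hg.continuousAt.eventually
    ((h.param q').open_source.mem_nhds (hgv.symm ▸ hw)), hπg] with x hx hπx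
  rw [Function.comp_apply, ← hπx, Function.comp_apply, h.param_symm_apply hx]

/-- The charts of `V` near the chosen representatives, carried over to `Q`. -/
@[reducible]
noncomputable def chartedSpace : ChartedSpace H Q where
  atlas := Set.range fun q => (h.param q).symm ≫ₕ chartAt H (h.rep q)
  chartAt q := (h.param q).symm ≫ₕ chartAt H (h.rep q)
  mem_chart_source q := by
    rw [OpenPartialHomeomorph.trans_source]
    refine ⟨h.mem_param_target q, ?_⟩
    rw [Set.mem_preimage, h.param_symm_self]
    exact mem_chart_source H (h.rep q)
  chart_mem_atlas q := ⟨q, rfl⟩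

theorem isManifold [IsManifold I ∞ V] :
    letI := h.chartedSpace
    IsManifold I ∞ Q := by
  let _ := h.chartedSpace
  apply isManifold_of_contDiffOn
  rintro _ _ ⟨q, rfl⟩ ⟨q', rfl⟩ y ⟨hy, hyr⟩
  simp only [Set.mem_preimage, OpenPartialHomeomorph.trans_source,
    OpenPartialHomeomorph.symm_source, OpenPartialHomeomorph.trans_symm_eq_symm_trans_symm,
    OpenPartialHomeomorph.symm_symm, OpenPartialHomeomorph.coe_trans, Set.mem_inter_iff,
    Function.comp] at hy
  obtain ⟨⟨hy_chart, hy_param⟩, hy_target, hy_source⟩ := hy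
  set v := (chartAt H (h.rep q)).symm (I.symm y) with hv
  have hv_source : v ∈ (chartAt H (h.rep q)).source := (chartAt H (h.rep q)).map_target hy_chart
  have hv_coord : extChartAt I (h.rep q) v = y := by
    rw [extChartAt_coe, Function.comp, hv, (chartAt H (h.rep q)).right_inv hy_chart,
      I.right_inv hyr]
  have hsmooth := (h.oriented_param_symm_comp_param q q' hy_param hy_target).1.contMDiffAt
  have hdiff := ((contMDiffAt_iff_of_mem_source hv_source hy_source).1 hsmooth).2
  rw [hv_coord] at hdiff
  exact hdiff.mono Set.inter_subset_right

theorem mem_boundary_iff_rep (q : Q) :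
    letI := h.chartedSpace
    q ∈ I.boundary Q ↔ h.rep q ∈ I.boundary V := by
  let _ := h.chartedSpace
  have hext : extChartAt I q q = extChartAt I (h.rep q) (h.rep q) :=
    congrArg (extChartAt I (h.rep q)) (h.param_symm_self q)
  change extChartAt I q q ∈ frontier _ ↔ _
  rw [hext]
  rfl

theorem oriented_rep [IsManifold I ∞ V] (q : Q) :
    letI := h.chartedSpace
    OrientedLocalDiffeoAt I I σ (fun q => σ (h.rep q)) π (h.rep q) := by
  let _ := h.chartedSpace
  have := h.isManifold
  refine .of_chartAt_comp_eventuallyEq (h.isLocalHomeomorphOn.continuousAt (h.rep_mem q)) ?_ ?_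
  · rw [h.apply_rep]
    filter_upwards [(h.param q).open_source.mem_nhds (h.rep_mem_param_source q)] with v hv
    exact congrArg (chartAt H (h.rep q)) (h.param_symm_apply hv)
  · rw [h.apply_rep]

theorem oriented [IsManifold I ∞ V] {v : V} (hv : v ∈ U) :
    letI := h.chartedSpace
    OrientedLocalDiffeoAt I I σ (fun q => σ (h.rep q)) π v := by
  let _ := h.chartedSpace
  obtain ⟨g, hg, hgv, hπg⟩ := h.exists_germ v hv _ (h.rep_mem (π v)) (h.apply_rep _).symm
  have hπ := h.oriented_rep (π v)
  rw [← hgv] at hπ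
  exact (hπ.comp hg).congr_of_eventuallyEq hπg.symm

theorem oriented_param_symm [IsManifold I ∞ V] (q : Q) {y : Q} (hy : y ∈ (h.param q).target) :
    letI := h.chartedSpace
    OrientedLocalDiffeoAt I I (fun q => σ (h.rep q)) σ (h.param q).symm y := by
  let _ := h.chartedSpace
  have hv := (h.param q).map_target hy
  have hsymm := (h.oriented (h.param_source_subset q hv)).of_leftInverse
      (g := (h.param q).symm) <| by
    filter_upwards [(h.param q).open_source.mem_nhds hv] with x hx using h.param_symm_apply hx
  rwa [h.apply_param_symm hy] at hsymm

theorem isOrientation [IsManifold I ∞ V] (hσ : IsOrientation I σ) :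
    letI := h.chartedSpace
    IsOrientation I (fun q : Q => σ (h.rep q)) := by
  let _ := h.chartedSpace
  intro q
  have hrep := (h.param q).continuousAt_symm (h.mem_param_target q)
  rw [ContinuousAt, h.param_symm_self] at hrep
  filter_upwards [hrep.eventually (hσ (h.rep q)),
    hrep.eventually (chart_source_mem_nhds H (h.rep q)),
    (h.param q).open_target.mem_nhds (h.mem_param_target q)] with y hpos hys hyt
  have hsymm := h.oriented_param_symm q hyt
  have hdet : (chartDeriv I 𝓘(ℝ, E) (extChartAt I q) y).det =
      (chartDeriv I 𝓘(ℝ, E) (extChartAt I (h.rep q)) ((h.param q).symm y)).det *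
        (chartDeriv I I (h.param q).symm y).det := by
    rw [show (extChartAt I q : Q → E) = extChartAt I (h.rep q) ∘ (h.param q).symm from rfl,
      chartDeriv_comp (mdifferentiableAt_extChartAt (I := I) hys)
        (hsymm.1.mdifferentiableAt infty_ne_zero')]
    exact LinearMap.det_comp _ _
  rw [hdet]
  have hsq : ((σ ((h.param q).symm y) : ℤ) : ℝ) * ((σ ((h.param q).symm y) : ℤ) : ℝ) = 1 := by
    norm_cast
    rw [Int.units_mul_self]
    simp
  have hprod := mul_pos hpos hsymm.2
  push_cast at hprod ⊢
  linear_combination hprod + (((σ (h.rep q) : ℤ) : ℝ) * ((σ (h.rep y) : ℤ) : ℝ) *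
    (chartDeriv I 𝓘(ℝ, E) (extChartAt I (h.rep q)) ((h.param q).symm y)).det *
      (chartDeriv I I (h.param q).symm y).det) * hsq

end IsOrientedQuotient

section HalfLine
open WithLp Set

/-- The point of the half-line `[0,∞)` with coordinate `max r 0`. -/
noncomputable def halfLinePoint (r : ℝ) : EuclideanHalfSpace 1 := (𝓡∂ 1).symm (toLp 2 fun _ => r)

theorem halfLinePoint_coord (r : ℝ) : (halfLinePoint r).1 0 = max r 0 := by
  simp [halfLinePoint, modelWithCornersEuclideanHalfSpace_symm_apply]

theorem halfLinePoint_self (t : EuclideanHalfSpace 1) : halfLinePoint (t.1 0) = t :=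
  halfSpace_ext ((halfLinePoint_coord _).trans (max_eq_left t.2))

theorem continuous_halfLinePoint : Continuous halfLinePoint :=
  (𝓡∂ 1).continuous_symm.comp (by fun_prop)

theorem continuous_halfLineCoord : Continuous fun t : EuclideanHalfSpace 1 => t.1 0 :=
  contMDiff_halfSpaceCoord.continuous

theorem isCompact_halfLine_le (r : ℝ) : IsCompact {t : EuclideanHalfSpace 1 | t.1 0 ≤ r} :=
  (isCompact_Icc.image (s := Icc 0 r) continuous_halfLinePoint).of_isClosed_subset
    (isClosed_le continuous_halfLineCoord continuous_const)
    fun t ht => ⟨t.1 0, ⟨t.2, ht⟩, halfLinePoint_self t⟩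

theorem isCompact_collar_le (N : Type*) [TopologicalSpace N] [CompactSpace N] (r : ℝ) :
    IsCompact {z : N × EuclideanHalfSpace 1 | z.2.1 0 ≤ r} := by
  convert! isCompact_univ.prod (s := (univ : Set N)) (isCompact_halfLine_le r) using 1
  ext z
  simp

theorem chartDeriv_halfLineCoord (t : EuclideanHalfSpace 1) (v : EuclideanSpace ℝ (Fin 1)) :
    chartDeriv (𝓡∂ 1) 𝓘(ℝ, ℝ) (fun y : EuclideanHalfSpace 1 => y.1 0) t v = v 0 := by
  have hchart : MDifferentiableAt (𝓡∂ 1) 𝓘(ℝ, EuclideanSpace ℝ (Fin 1)) (extChartAt (𝓡∂ 1) t) t :=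
    mdifferentiableAt_extChartAt (mem_chart_source _ t)
  have hcoord := mfderiv_coord hchart v
  rw [chartDeriv_extChartAt_self] at hcoord
  exact hcoord

theorem det_chartDeriv_of_hasDerivAt_coord {φ : EuclideanHalfSpace 1 → EuclideanHalfSpace 1}
    {t : EuclideanHalfSpace 1} {g : ℝ → ℝ} {g' : ℝ} (hφ : MDifferentiableAt (𝓡∂ 1) (𝓡∂ 1) φ t)
    (hg : HasDerivAt g g' (t.1 0)) (hφg : ∀ᶠ s in 𝓝 t, (φ s).1 0 = g (s.1 0)) :
    (chartDeriv (𝓡∂ 1) (𝓡∂ 1) φ t).det = g' := by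
  have hcoord (s : EuclideanHalfSpace 1) :
      MDifferentiableAt (𝓡∂ 1) 𝓘(ℝ, ℝ) (fun y : EuclideanHalfSpace 1 => y.1 0) s :=
    (contMDiff_halfSpaceCoord s).mdifferentiableAt (by simp)
  have hg_mfderiv : chartDeriv 𝓘(ℝ, ℝ) 𝓘(ℝ, ℝ) g (t.1 0) =
      ContinuousLinearMap.toSpanSingleton ℝ g' := hg.hasFDerivAt.hasMFDerivAt.mfderiv
  have hchain : chartDeriv (𝓡∂ 1) 𝓘(ℝ, ℝ) ((fun y : EuclideanHalfSpace 1 => y.1 0) ∘ φ) t =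
      chartDeriv (𝓡∂ 1) 𝓘(ℝ, ℝ) (g ∘ fun y : EuclideanHalfSpace 1 => y.1 0) t :=
    Filter.EventuallyEq.mfderiv_eq hφg
  rw [chartDeriv_comp (hcoord (φ t)) hφ,
    chartDeriv_comp (f := fun y : EuclideanHalfSpace 1 => y.1 0)
      hg.hasFDerivAt.hasMFDerivAt.mdifferentiableAt (hcoord t), hg_mfderiv] at hchain
  have hbasis := congrArg
    (fun A : EuclideanSpace ℝ (Fin 1) →L[ℝ] ℝ => A (EuclideanSpace.single 0 1)) hchain
  simp only [ContinuousLinearMap.comp_apply, chartDeriv_halfLineCoord,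
    ContinuousLinearMap.toSpanSingleton_apply] at hbasis
  rw [det_fin_one, hbasis]
  simp

/-- The reflection `t ↦ 1 - t` of `[0,1]`, extended by zero to the half-line. -/
noncomputable def flip (t : EuclideanHalfSpace 1) : EuclideanHalfSpace 1 :=
  halfLinePoint (1 - t.1 0)

theorem flip_coord (t : EuclideanHalfSpace 1) : (flip t).1 0 = max (1 - t.1 0) 0 :=
  halfLinePoint_coord _

theorem flip_coord_of_le {t : EuclideanHalfSpace 1} (ht : t.1 0 ≤ 1) :
    (flip t).1 0 = 1 - t.1 0 := by
  rw [flip_coord, max_eq_left (sub_nonneg.2 ht)]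

theorem continuous_flip : Continuous flip :=
  continuous_halfLinePoint.comp (continuous_const.sub continuous_halfLineCoord)

theorem flip_flip {t : EuclideanHalfSpace 1} (ht : t.1 0 ≤ 1) : flip (flip t) = t := by
  apply halfSpace_ext
  rw [flip_coord, flip_coord_of_le ht, sub_sub_cancel, max_eq_left t.2]

theorem flip_le_one (t : EuclideanHalfSpace 1) : (flip t).1 0 ≤ 1 := by
  rw [flip_coord]
  exact max_le (by linarith [t.2]) zero_le_one

theorem contMDiffOn_flip :
    ContMDiffOn (𝓡∂ 1) (𝓡∂ 1) ∞ flip {t : EuclideanHalfSpace 1 | t.1 0 ≤ 1} := by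
  have hreflect : ContDiff ℝ ∞ fun r : ℝ => (toLp 2 fun _ => 1 - r : EuclideanSpace ℝ (Fin 1)) := by
    rw [contDiff_euclidean]
    intro i
    fun_prop
  refine (ModelWithCorners.contMDiffOn_symm (𝓡∂ 1)).comp
    (hreflect.contMDiff.comp contMDiff_halfSpaceCoord).contMDiffOn fun t ht => ?_
  rw [range_modelWithCornersEuclideanHalfSpace]
  simpa using ht

theorem isLocalDiffeomorphAt_flip {t : EuclideanHalfSpace 1} (h0 : 0 < t.1 0) (h1 : t.1 0 < 1) :
    IsLocalDiffeomorphAt (𝓡∂ 1) (𝓡∂ 1) ∞ flip t := by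
  have hopen : IsOpen {t : EuclideanHalfSpace 1 | 0 < t.1 0 ∧ t.1 0 < 1} :=
    (isOpen_lt continuous_const continuous_halfLineCoord).inter
      (isOpen_lt continuous_halfLineCoord continuous_const)
  have hmaps : ∀ t ∈ {t : EuclideanHalfSpace 1 | 0 < t.1 0 ∧ t.1 0 < 1},
      flip t ∈ {t : EuclideanHalfSpace 1 | 0 < t.1 0 ∧ t.1 0 < 1} := by
    rintro t ⟨h0, h1⟩
    rw [mem_ofPred_eq, flip_coord_of_le h1.le]
    constructor <;> linarith
  have hsmooth : ContMDiffOn (𝓡∂ 1) (𝓡∂ 1) ∞ flip {t | 0 < t.1 0 ∧ t.1 0 < 1} :=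
    contMDiffOn_flip.mono fun t ht => ht.2.le
  exact ⟨{ toFun := flip, invFun := flip, source := {t | 0 < t.1 0 ∧ t.1 0 < 1},
           target := {t | 0 < t.1 0 ∧ t.1 0 < 1}, map_source' := hmaps, map_target' := hmaps,
           left_inv' := fun t ht => flip_flip ht.2.le, right_inv' := fun t ht => flip_flip ht.2.le,
           open_source := hopen, open_target := hopen,
           contMDiffOn_toFun := hsmooth, contMDiffOn_invFun := hsmooth },
    ⟨h0, h1⟩, fun _ _ => rfl⟩

theorem oriented_flip {t : EuclideanHalfSpace 1} (h0 : 0 < t.1 0) (h1 : t.1 0 < 1) :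
    OrientedLocalDiffeoAt (𝓡∂ 1) (𝓡∂ 1) (fun _ => 1) (fun _ => -1) flip t := by
  have hflip := isLocalDiffeomorphAt_flip h0 h1
  have hcoord : ∀ᶠ s in 𝓝 t, (flip s).1 0 = 1 - s.1 0 := by
    filter_upwards [(isOpen_lt continuous_halfLineCoord continuous_const).mem_nhds h1] with s hs
    exact flip_coord_of_le (le_of_lt hs)
  refine ⟨hflip, ?_⟩
  rw [det_chartDeriv_of_hasDerivAt_coord (hflip.mdifferentiableAt infty_ne_zero')
    ((hasDerivAt_id (t.1 0)).const_sub 1) hcoord]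
  norm_num

/-- A self-map of the half-line that is zero on `[0,1]` and the identity on `[2,∞)`. -/
noncomputable def collapse (t : EuclideanHalfSpace 1) : EuclideanHalfSpace 1 :=
  halfLinePoint (min (2 * (t.1 0 - 1)) (t.1 0))

theorem continuous_collapse : Continuous collapse :=
  continuous_halfLinePoint.comp (((continuous_halfLineCoord.sub continuous_const).const_mul 2).min
    continuous_halfLineCoord)

theorem collapse_of_le {t : EuclideanHalfSpace 1} (ht : t.1 0 ≤ 1) : collapse t = 0 := by
  apply halfSpace_ext
  rw [collapse, halfLinePoint_coord]
  exact max_eq_right ((min_le_left _ _).trans (by linarith))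

theorem collapse_of_ge {t : EuclideanHalfSpace 1} (ht : 2 ≤ t.1 0) : collapse t = t := by
  rw [collapse, min_eq_right (by linarith), halfLinePoint_self]

end HalfLine

theorem continuous_extend_comp_id {D V : Type*} [TopologicalSpace D] [TopologicalSpace V]
    {e : D → V} (he : Topology.IsOpenEmbedding e) {ψ : D → D} (hψ : Continuous ψ) {K : Set D}
    (hK : IsClosed (e '' K)) (hψK : ∀ z ∉ K, ψ z = z) :
    Continuous (Function.extend e (e ∘ ψ) id) := by
  rw [continuous_iff_continuousAt]
  intro v
  by_cases hv : v ∈ e '' K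
  · obtain ⟨z, -, rfl⟩ := hv
    have hcomp : Function.extend e (e ∘ ψ) id ∘ e = e ∘ ψ :=
      funext fun z => he.injective.extend_apply _ _ z
    rw [← he.continuousAt_iff, hcomp]
    exact (he.continuous.comp hψ).continuousAt
  · refine continuousAt_id.congr ?_
    filter_upwards [hK.isOpen_compl.mem_nhds hv] with w hw
    by_cases hr : ∃ z, e z = w
    · obtain ⟨z, rfl⟩ := hr
      rw [he.injective.extend_apply, Function.comp_apply, hψK z fun hz => hw ⟨z, hz, rfl⟩, id]
    · rw [Function.extend_apply' _ _ _ hr]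

/-- Two disjoint open collars `N × [0,∞) → V`, to be glued along `N × [0,1]` by reversing the
interval. -/
structure TwoCollars (N V : Type*) [TopologicalSpace N] [TopologicalSpace V] where
  left : N × EuclideanHalfSpace 1 → V
  right : N × EuclideanHalfSpace 1 → V
  isOpenEmbedding : Topology.IsOpenEmbedding (Sum.elim left right)

namespace TwoCollars
variable {N V : Type*} [TopologicalSpace N] [TopologicalSpace V] (P : TwoCollars N V)

/-- The same two collars in the other order. -/
def swap : TwoCollars N V where
  left := P.right
  right := P.left
  isOpenEmbedding := by
    convert! P.isOpenEmbedding.comp (Homeomorph.sumComm _ _).isOpenEmbedding using 1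
    ext (z | z) <;> rfl

theorem isOpenEmbedding_left : Topology.IsOpenEmbedding P.left :=
  P.isOpenEmbedding.comp Topology.IsOpenEmbedding.inl

theorem isOpenEmbedding_right : Topology.IsOpenEmbedding P.right :=
  P.isOpenEmbedding.comp Topology.IsOpenEmbedding.inr

theorem left_ne_right (z z' : N × EuclideanHalfSpace 1) : P.left z ≠ P.right z' := fun h =>
  Sum.inl_ne_inr (P.isOpenEmbedding.injective (a₁ := Sum.inl z) (a₂ := Sum.inr z') h)

/-- The relation that identifies `left (x, t)` with `right (x, 1 - t)` for `t ∈ [0,1]`. -/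
def Rel (v w : V) : Prop :=
  ∃ (x : N) (t : EuclideanHalfSpace 1), t.1 0 ≤ 1 ∧ P.left (x, t) = v ∧ P.right (x, flip t) = w

theorem rel_swap {v w : V} : P.swap.Rel v w ↔ P.Rel w v := by
  constructor <;>
  · rintro ⟨x, t, ht, rfl, rfl⟩
    exact ⟨x, flip t, flip_le_one t, rfl, by rw [flip_flip ht]; rfl⟩

variable {P} in
theorem Rel.right_unique {v w w' : V} (h : P.Rel v w) (h' : P.Rel v w') : w = w' := by
  obtain ⟨x, t, -, rfl, rfl⟩ := h
  obtain ⟨y, s, -, hys, rfl⟩ := h'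
  obtain ⟨rfl, rfl⟩ := Prod.mk.inj (P.isOpenEmbedding_left.injective hys)
  rfl

variable {P} in
theorem Rel.left_unique {v v' w : V} (h : P.Rel v w) (h' : P.Rel v' w) : v = v' :=
  (P.rel_swap.2 h).right_unique (P.rel_swap.2 h')

variable {P} in
theorem Rel.not_rel {v w w' : V} (h : P.Rel v w) : ¬ P.Rel w w' := by
  obtain ⟨x, t, -, rfl, rfl⟩ := h
  rintro ⟨y, s, -, hys, -⟩
  exact P.left_ne_right _ _ hys

/-- The equivalence relation generated by `Rel`; each of its classes has at most two elements. -/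
def setoid : Setoid V where
  r v w := v = w ∨ P.Rel v w ∨ P.Rel w v
  iseqv :=
    { refl := fun _ => Or.inl rfl
      symm := by
        rintro v w (h | h | h)
        · exact Or.inl h.symm
        · exact Or.inr (Or.inr h)
        · exact Or.inr (Or.inl h)
      trans := by
        rintro v w u (rfl | h | h) (rfl | h' | h')
        · exact Or.inl rfl
        · exact Or.inr (Or.inl h')
        · exact Or.inr (Or.inr h')
        · exact Or.inr (Or.inl h)
        · exact (h.not_rel h').elim
        · exact Or.inl (h.left_unique h')
        · exact Or.inr (Or.inr h)
        · exact Or.inl (h.right_unique h')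
        · exact (h'.not_rel h).elim }

/-- The space obtained from `V` by gluing the two collars along `N × [0,1]`. The end of each collar
becomes an interior slice of the other one. -/
def Glued : Type _ := Quotient P.setoid

instance : TopologicalSpace P.Glued := inferInstanceAs (TopologicalSpace (Quotient P.setoid))

instance [CompactSpace V] : CompactSpace P.Glued :=
  inferInstanceAs (CompactSpace (Quotient P.setoid))

/-- The quotient map onto the glued space. -/
def proj (v : V) : P.Glued := Quotient.mk P.setoid v

theorem continuous_proj : Continuous P.proj := continuous_quotient_mk'

theorem proj_surjective : Function.Surjective P.proj := Quotient.mk_surjective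

variable {P}

theorem proj_eq_proj_iff {v w : V} : P.proj v = P.proj w ↔ v = w ∨ P.Rel v w ∨ P.Rel w v :=
  Quotient.eq (r := P.setoid)

theorem Rel.proj_eq {v w : V} (h : P.Rel v w) : P.proj v = P.proj w :=
  proj_eq_proj_iff.2 (Or.inr (Or.inl h))

theorem eq_of_proj_eq_of_notMem_range {v w : V} (h : P.proj v = P.proj w)
    (hleft : v ∉ Set.range P.left) (hright : v ∉ Set.range P.right) : v = w := by
  rcases proj_eq_proj_iff.1 h with h | ⟨x, t, -, hv, -⟩ | ⟨x, t, -, -, hv⟩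
  · exact h
  · exact (hleft ⟨_, hv⟩).elim
  · exact (hright ⟨_, hv⟩).elim

theorem injOn_proj_compl_left : Set.InjOn P.proj (P.left '' {z | z.2.1 0 ≤ 1})ᶜ := by
  intro v hv w hw h
  rcases proj_eq_proj_iff.1 h with h | ⟨x, t, ht, hx, -⟩ | ⟨x, t, ht, hx, -⟩
  · exact h
  · exact (hv ⟨(x, t), ht, hx⟩).elim
  · exact (hw ⟨(x, t), ht, hx⟩).elim

theorem injOn_proj_compl_right : Set.InjOn P.proj (P.right '' {z | z.2.1 0 ≤ 1})ᶜ := by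
  intro v hv w hw h
  rcases proj_eq_proj_iff.1 h with h | ⟨x, t, -, -, hx⟩ | ⟨x, t, -, -, hx⟩
  · exact h
  · exact (hw ⟨(x, flip t), flip_le_one t, hx⟩).elim
  · exact (hv ⟨(x, flip t), flip_le_one t, hx⟩).elim

variable (P)

/-- The complement of the ends of the collars; the quotient map is a local homeomorphism there. -/
def interior : Set V :=
  (Set.range (fun x => P.left (x, 0)) ∪ Set.range (fun x => P.right (x, 0)))ᶜ

theorem interior_swap : P.swap.interior = P.interior := by
  rw [interior, interior, Set.union_comm]
  rfl

theorem mem_interior_of_notMem_range {v : V} (hleft : v ∉ Set.range P.left)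
    (hright : v ∉ Set.range P.right) : v ∈ P.interior := by
  rintro (⟨x, hx⟩ | ⟨x, hx⟩)
  · exact hleft ⟨_, hx⟩
  · exact hright ⟨_, hx⟩

theorem left_mem_interior_iff {x : N} {t : EuclideanHalfSpace 1} :
    P.left (x, t) ∈ P.interior ↔ 0 < t.1 0 := by
  constructor
  · intro h
    refine lt_of_le_of_ne t.2 fun h0 => h (Or.inl ⟨x, ?_⟩)
    rw [show t = 0 from halfSpace_ext h0.symm]
  · rintro h (⟨y, hy⟩ | ⟨y, hy⟩)
    · obtain ⟨-, rfl⟩ := Prod.mk.inj (P.isOpenEmbedding_left.injective hy)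
      exact lt_irrefl _ h
    · exact P.left_ne_right _ _ hy.symm

theorem right_mem_interior_iff {x : N} {t : EuclideanHalfSpace 1} :
    P.right (x, t) ∈ P.interior ↔ 0 < t.1 0 := by
  rw [← P.interior_swap]
  exact P.swap.left_mem_interior_iff

theorem coord_lt_one_of_right_flip_mem_interior {x : N} {t : EuclideanHalfSpace 1}
    (h : P.right (x, flip t) ∈ P.interior) : t.1 0 < 1 := by
  rw [right_mem_interior_iff, flip_coord, lt_max_iff] at h
  linarith [h.resolve_right (lt_irrefl 0)]

theorem surjOn_proj_interior : Set.SurjOn P.proj P.interior Set.univ := by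
  have hflip : 0 < (flip 0).1 0 := by
    rw [flip_coord_of_le zero_le_one]
    exact sub_pos.2 zero_lt_one
  have hrel (Q : TwoCollars N V) (x : N) : Q.Rel (Q.left (x, 0)) (Q.right (x, flip 0)) :=
    ⟨x, 0, zero_le_one, rfl, rfl⟩
  intro q _
  obtain ⟨v, rfl⟩ := P.proj_surjective q
  by_cases hv : v ∈ P.interior
  · exact ⟨v, hv, rfl⟩
  · obtain ⟨x, rfl⟩ | ⟨x, rfl⟩ := Set.notMem_compl_iff.1 hv
    · exact ⟨_, P.right_mem_interior_iff.2 hflip, (hrel P x).proj_eq.symm⟩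
    · exact ⟨_, P.left_mem_interior_iff.2 hflip, (P.rel_swap.1 (hrel P.swap x)).proj_eq⟩

theorem continuous_right_flip :
    Continuous fun z : N × EuclideanHalfSpace 1 => P.right (z.1, flip z.2) :=
  P.isOpenEmbedding_right.continuous.comp
    (continuous_fst.prodMk (continuous_flip.comp continuous_snd))

theorem isOpen_setOf_rel {O : Set V} (hO : IsOpen O) (hOi : O ⊆ P.interior) :
    IsOpen {v | ∃ w ∈ O, P.Rel v w} := by
  have himage : {v | ∃ w ∈ O, P.Rel v w} =
      P.left '' ((fun z => P.right (z.1, flip z.2)) ⁻¹' O) := by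
    ext v
    constructor
    · rintro ⟨_, hw, x, t, -, rfl, rfl⟩
      exact ⟨(x, t), hw, rfl⟩
    · rintro ⟨⟨x, t⟩, hw, rfl⟩
      exact ⟨_, hw, x, t, (P.coord_lt_one_of_right_flip_mem_interior (hOi hw)).le, rfl, rfl⟩
  rw [himage]
  exact P.isOpenEmbedding_left.isOpenMap _ (hO.preimage P.continuous_right_flip)

theorem isOpen_proj_image {O : Set V} (hO : IsOpen O) (hOi : O ⊆ P.interior) :
    IsOpen (P.proj '' O) := by
  have hsaturation : P.proj ⁻¹' (P.proj '' O) =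
      O ∪ ({v | ∃ w ∈ O, P.Rel v w} ∪ {v | ∃ w ∈ O, P.swap.Rel v w}) := by
    ext v
    constructor
    · rintro ⟨w, hw, h⟩
      rcases proj_eq_proj_iff.1 h with rfl | h | h
      · exact Or.inl hw
      · exact Or.inr (Or.inr ⟨w, hw, P.rel_swap.2 h⟩)
      · exact Or.inr (Or.inl ⟨w, hw, h⟩)
    · rintro (hv | ⟨w, hw, h⟩ | ⟨w, hw, h⟩)
      · exact ⟨v, hv, rfl⟩
      · exact ⟨w, hw, h.proj_eq.symm⟩
      · exact ⟨w, hw, (P.rel_swap.1 h).proj_eq⟩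
  have hpreimage : IsOpen (P.proj ⁻¹' (P.proj '' O)) := by
    rw [hsaturation]
    exact hO.union ((P.isOpen_setOf_rel hO hOi).union
      (P.swap.isOpen_setOf_rel hO (P.interior_swap.symm ▸ hOi)))
  exact hpreimage

section CompactCollars
variable [CompactSpace N] [T2Space V]

theorem isClosed_left_image_le (r : ℝ) : IsClosed (P.left '' {z | z.2.1 0 ≤ r}) :=
  ((isCompact_collar_le N r).image P.isOpenEmbedding_left.continuous).isClosed

theorem isOpen_interior : IsOpen P.interior :=
  (IsClosed.union
    (isCompact_range (P.isOpenEmbedding_left.continuous.comp (by fun_prop))).isClosed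
    (isCompact_range (P.isOpenEmbedding_right.continuous.comp (by fun_prop))).isClosed).isOpen_compl

theorem isClosed_setOf_rel : IsClosed {q : V × V | P.Rel q.1 q.2} := by
  have himage : {q : V × V | P.Rel q.1 q.2} =
      (fun z : N × EuclideanHalfSpace 1 => (P.left z, P.right (z.1, flip z.2))) ''
        {z | z.2.1 0 ≤ 1} := by
    ext ⟨v, w⟩
    constructor
    · rintro ⟨x, t, ht, rfl, rfl⟩
      exact ⟨(x, t), ht, rfl⟩
    · rintro ⟨⟨x, t⟩, ht, h⟩
      exact ⟨x, t, ht, congrArg Prod.fst h, congrArg Prod.snd h⟩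
  rw [himage]
  exact ((isCompact_collar_le N 1).image
    (P.isOpenEmbedding_left.continuous.prodMk P.continuous_right_flip)).isClosed

instance : T2Space P.Glued := by
  have hquotient : IsOpenQuotientMap fun v : P.interior => P.proj v := by
    refine ⟨fun q => ?_, P.continuous_proj.comp continuous_subtype_val, fun O hO => ?_⟩
    · obtain ⟨v, hv, hq⟩ := P.surjOn_proj_interior (Set.mem_univ q)
      exact ⟨⟨v, hv⟩, hq⟩
    · rw [← Function.comp_def P.proj, Set.image_comp]
      exact P.isOpen_proj_image (P.isOpen_interior.isOpenMap_subtype_val O hO)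
        (Subtype.coe_image_subset _ _)
  have hclosed : IsClosed {q : V × V | P.proj q.1 = P.proj q.2} := by
    simp only [proj_eq_proj_iff]
    exact isClosed_diagonal.union
      (P.isClosed_setOf_rel.union (P.isClosed_setOf_rel.preimage continuous_swap))
  rw [t2Space_iff_of_isOpenQuotientMap hquotient]
  exact hclosed.preimage (continuous_subtype_val.prodMap continuous_subtype_val)

theorem exists_isOpen_injOn_proj (v : V) : ∃ O, IsOpen O ∧ v ∈ O ∧ Set.InjOn P.proj O := by
  by_cases hv : v ∈ P.left '' {z | z.2.1 0 ≤ 1}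
  · refine ⟨_, (P.swap.isClosed_left_image_le 1).isOpen_compl, ?_, injOn_proj_compl_right⟩
    rintro ⟨z, -, hz⟩
    obtain ⟨z', -, hz'⟩ := hv
    exact P.left_ne_right _ _ (hz'.trans hz.symm)
  · exact ⟨_, (P.isClosed_left_image_le 1).isOpen_compl, hv, injOn_proj_compl_left⟩

theorem isLocalHomeomorphOn_proj : IsLocalHomeomorphOn P.proj P.interior := by
  rw [isLocalHomeomorphOn_iff_isOpenEmbedding_restrict]
  intro v hv
  obtain ⟨O, hO, hvO, hinj⟩ := P.exists_isOpen_injOn_proj v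
  have hopen := hO.inter P.isOpen_interior
  refine ⟨O ∩ P.interior, hopen.mem_nhds ⟨hvO, hv⟩,
    .of_continuous_injective_isOpenMap (P.continuous_proj.comp continuous_subtype_val)
      (hinj.mono Set.inter_subset_left).injective fun S hS => ?_⟩
  rw [Set.domRestrict_eq, Set.image_comp]
  exact P.isOpen_proj_image (hopen.isOpenMap_subtype_val S hS)
    ((Subtype.coe_image_subset _ _).trans Set.inter_subset_right)

end CompactCollars

/-- The self-map of `V` that collapses the two collars `N × [0,1]` to their ends and is the
identity off the collars `N × [0,2]`. -/
noncomputable def collapseMap : V → V :=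
  Function.extend (Sum.elim P.left P.right) (Sum.elim P.left P.right ∘
    Sum.map (Prod.map id collapse) (Prod.map id collapse)) id

theorem collapseMap_left {x : N} {t : EuclideanHalfSpace 1} (ht : t.1 0 ≤ 1) :
    P.collapseMap (P.left (x, t)) = P.left (x, 0) := by
  refine (P.isOpenEmbedding.injective.extend_apply _ _ (Sum.inl (x, t))).trans ?_
  change P.left (x, collapse t) = _
  rw [collapse_of_le ht]

theorem collapseMap_right {x : N} {t : EuclideanHalfSpace 1} (ht : t.1 0 ≤ 1) :
    P.collapseMap (P.right (x, t)) = P.right (x, 0) := by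
  refine (P.isOpenEmbedding.injective.extend_apply _ _ (Sum.inr (x, t))).trans ?_
  change P.right (x, collapse t) = _
  rw [collapse_of_le ht]

theorem collapseMap_of_notMem_range {v : V} (hleft : v ∉ Set.range P.left)
    (hright : v ∉ Set.range P.right) : P.collapseMap v = v :=
  Function.extend_apply' _ _ _ <| by
    rintro ⟨z | z, hz⟩
    exacts [hleft ⟨z, hz⟩, hright ⟨z, hz⟩]

theorem continuous_collapseMap [CompactSpace N] [T2Space V] : Continuous P.collapseMap := by
  have hcollapse : Continuous (Prod.map id collapse : N × EuclideanHalfSpace 1 → _) :=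
    continuous_id.prodMap continuous_collapse
  have hid : ∀ z : N × EuclideanHalfSpace 1, ¬ z.2.1 0 ≤ 2 → Prod.map id collapse z = z :=
    fun z hz => Prod.ext rfl (collapse_of_ge (not_le.1 hz).le)
  have hK := isCompact_collar_le N 2
  refine continuous_extend_comp_id P.isOpenEmbedding (hcollapse.sumMap hcollapse)
    (((hK.image continuous_inl).union (hK.image continuous_inr)).image
      P.isOpenEmbedding.continuous).isClosed ?_
  rintro (z | z) hz
  · exact congrArg Sum.inl (hid z fun h => hz (Or.inl ⟨z, h, rfl⟩))
  · exact congrArg Sum.inr (hid z fun h => hz (Or.inr ⟨z, h, rfl⟩))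

/-- A map on `V` that agrees on the ends of the two collars induces, after collapsing the collars,
a map on the glued space. -/
noncomputable def descend [CompactSpace N] [T2Space V] {A : Type*} [TopologicalSpace A]
    (h : C(V, A)) (hends : ∀ x, h (P.left (x, 0)) = h (P.right (x, 0))) : C(P.Glued, A) where
  toFun := Quotient.lift (s := P.setoid) (fun v => h (P.collapseMap v)) <| by
    have hrel : ∀ v w, P.Rel v w → h (P.collapseMap v) = h (P.collapseMap w) := by
      rintro _ _ ⟨x, t, ht, rfl, rfl⟩
      rw [P.collapseMap_left ht, P.collapseMap_right (flip_le_one t), hends]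
    rintro v w (rfl | hvw | hwv)
    · rfl
    · exact hrel _ _ hvw
    · exact (hrel _ _ hwv).symm
  continuous_toFun := (h.continuous.comp P.continuous_collapseMap).quotient_lift _

section Oriented
variable {E H H' N V : Type*} [NormedAddCommGroup E] [NormedSpace ℝ E]
  [TopologicalSpace H] [TopologicalSpace H'] {I : ModelWithCorners ℝ E H}
  {J : ModelWithCorners ℝ (E × EuclideanSpace ℝ (Fin 1)) H'}
  [TopologicalSpace N] [ChartedSpace H N] [TopologicalSpace V] [ChartedSpace H' V]
  {P : TwoCollars N V} {ν : N → ℤˣ} {σ : V → ℤˣ}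

/-- The two collars are compatible with the orientations, with opposite signs on `N`: the left one
is the end of an oriented bordism to `N` and the right one the beginning of one from `N`. -/
structure IsOriented (I : ModelWithCorners ℝ E H)
    (J : ModelWithCorners ℝ (E × EuclideanSpace ℝ (Fin 1)) H') (P : TwoCollars N V)
    (ν : N → ℤˣ) (σ : V → ℤˣ) : Prop where
  left : ∀ z, OrientedLocalDiffeoAt (I.prod (𝓡∂ 1)) J (fun z : N × EuclideanHalfSpace 1 => -ν z.1) σ
    P.left z
  right : ∀ z, OrientedLocalDiffeoAt (I.prod (𝓡∂ 1)) J (fun z : N × EuclideanHalfSpace 1 => ν z.1) σ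
    P.right z

namespace IsOriented

theorem swap (hP : P.IsOriented I J ν σ) : P.swap.IsOriented I J (fun x => -ν x) σ where
  left z := (hP.right z).congr_orientation (by rw [neg_neg])
  right := hP.left

theorem right_flip [FiniteDimensional ℝ E] (hP : P.IsOriented I J ν σ) {x : N}
    {t : EuclideanHalfSpace 1} (h0 : 0 < t.1 0) (h1 : t.1 0 < 1) :
    OrientedLocalDiffeoAt (I.prod (𝓡∂ 1)) J (fun z : N × EuclideanHalfSpace 1 => -ν z.1) σ
      (P.right ∘ Prod.map (fun y => y) flip) (x, t) := by
  have hflip := ((OrientedLocalDiffeoAt.id (I := I) ν x).prodMap (x := (x, t))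
    (oriented_flip h0 h1)).congr_orientation (σ' := fun z => -ν z.1) (τ' := fun z => ν z.1)
    (by simp)
  exact (hP.right _).comp hflip

theorem exists_germ_of_rel [FiniteDimensional ℝ E] (hP : P.IsOriented I J ν σ) {v w : V}
    (hv : v ∈ P.interior) (hw : w ∈ P.interior) (h : P.Rel v w) :
    ∃ g : V → V, OrientedLocalDiffeoAt J J σ σ g v ∧ g v = w ∧ ∀ᶠ y in 𝓝 v, P.Rel y (g y) := by
  obtain ⟨x, t, -, rfl, rfl⟩ := h
  have h1 := P.coord_lt_one_of_right_flip_mem_interior hw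
  obtain ⟨g, hg, hgleft⟩ := (hP.left (x, t)).exists_comp_eventuallyEq
    (hP.right_flip (P.left_mem_interior_iff.1 hv) h1)
  refine ⟨g, hg, hgleft.eq_of_nhds, ?_⟩
  have hlt : ∀ᶠ z : N × EuclideanHalfSpace 1 in 𝓝 (x, t), z.2.1 0 < 1 :=
    (isOpen_lt (continuous_halfLineCoord.comp continuous_snd) continuous_const).mem_nhds h1
  rw [← P.isOpenEmbedding_left.map_nhds_eq, Filter.eventually_map]
  filter_upwards [hgleft, hlt] with z hz hz1
  exact ⟨z.1, z.2, hz1.le, rfl, hz.symm⟩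

theorem isOrientedQuotient [FiniteDimensional ℝ E] [CompactSpace N] [T2Space V]
    (hP : P.IsOriented I J ν σ) : IsOrientedQuotient J σ P.proj P.interior where
  isOpen := P.isOpen_interior
  isLocalHomeomorphOn := P.isLocalHomeomorphOn_proj
  surjOn := P.surjOn_proj_interior
  exists_germ v hv w hw h := by
    rcases proj_eq_proj_iff.1 h with rfl | h | h
    · exact ⟨fun y => y, .id σ v, rfl, .rfl⟩
    · obtain ⟨g, hg, hgv, hrel⟩ := hP.exists_germ_of_rel hv hw h
      exact ⟨g, hg, hgv, hrel.mono fun y hy => hy.proj_eq.symm⟩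
    · rw [← P.interior_swap] at hv hw
      obtain ⟨g, hg, hgv, hrel⟩ := hP.swap.exists_germ_of_rel hv hw (P.rel_swap.2 h)
      exact ⟨g, hg, hgv, hrel.mono fun y hy => (P.rel_swap.1 hy).proj_eq⟩

end IsOriented
end Oriented

section GluedManifold
variable {E H H' : Type} [NormedAddCommGroup E] [NormedSpace ℝ E] [FiniteDimensional ℝ E]
  [TopologicalSpace H] [TopologicalSpace H'] {I : ModelWithCorners ℝ E H}
  {J : ModelWithCorners ℝ (E × EuclideanSpace ℝ (Fin 1)) H'}
  {N : Type*} [TopologicalSpace N] [ChartedSpace H N] [CompactSpace N]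
  {V : CompactOrientedManifold J} {P : TwoCollars N V} {ν : N → ℤˣ}

/-- The glued space as an oriented manifold. -/
noncomputable def gluedManifold (hP : P.IsOriented I J ν V.orientation) :
    CompactOrientedManifold J where
  carrier := P.Glued
  charted := hP.isOrientedQuotient.chartedSpace
  smooth := hP.isOrientedQuotient.isManifold
  orientation q := V.orientation (hP.isOrientedQuotient.rep q)
  isOrientation := hP.isOrientedQuotient.isOrientation V.isOrientation

theorem rep_proj_of_notMem_range (hP : P.IsOriented I J ν V.orientation) {v : V}
    (hleft : v ∉ Set.range P.left) (hright : v ∉ Set.range P.right) :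
    hP.isOrientedQuotient.rep (P.proj v) = v :=
  (eq_of_proj_eq_of_notMem_range (hP.isOrientedQuotient.apply_rep _).symm hleft hright).symm

theorem oriented_proj_comp (hP : P.IsOriented I J ν V.orientation) {K D : Type*}
    [TopologicalSpace K] [TopologicalSpace D] [ChartedSpace K D]
    {L : ModelWithCorners ℝ (E × EuclideanSpace ℝ (Fin 1)) K} {δ : D → ℤˣ} {d : D → V} {z : D}
    (hleft : d z ∉ Set.range P.left) (hright : d z ∉ Set.range P.right)
    (hd : OrientedLocalDiffeoAt L J δ V.orientation d z) :
    OrientedLocalDiffeoAt (N := gluedManifold hP) L J δ (gluedManifold hP).orientation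
      (P.proj ∘ d) z :=
  OrientedLocalDiffeoAt.comp (P := gluedManifold hP)
    (hP.isOrientedQuotient.oriented (P.mem_interior_of_notMem_range hleft hright)) hd

end GluedManifold
end TwoCollars

namespace Bordism
variable {p : ℕ} {N₀ N₁ N₂ : CompactOrientedManifold (𝓡 p)}

theorem collar₀_injective (W : Bordism N₀ N₁) : Function.Injective W.collar₀ :=
  W.injective.comp Sum.inl_injective

theorem collar₁_injective (W : Bordism N₀ N₁) : Function.Injective W.collar₁ :=
  W.injective.comp Sum.inr_injective

theorem collar₀_ne_collar₁ (W : Bordism N₀ N₁) (z : N₀ × EuclideanHalfSpace 1)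
    (z' : N₁ × EuclideanHalfSpace 1) : W.collar₀ z ≠ W.collar₁ z' := fun h =>
  Sum.inl_ne_inr (W.injective (a₁ := Sum.inl z) (a₂ := Sum.inr z') h)

theorem isOpenEmbedding_collar₀ (W : Bordism N₀ N₁) : Topology.IsOpenEmbedding W.collar₀ :=
  IsLocalHomeomorph.isOpenEmbedding_of_injective
    (IsLocalDiffeomorph.isLocalHomeomorph fun z => (W.oriented₀ z).1) W.collar₀_injective

theorem isOpenEmbedding_collar₁ (W : Bordism N₀ N₁) : Topology.IsOpenEmbedding W.collar₁ :=
  IsLocalHomeomorph.isOpenEmbedding_of_injective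
    (IsLocalDiffeomorph.isLocalHomeomorph fun z => (W.oriented₁ z).1) W.collar₁_injective

section Trans
variable (W : Bordism N₀ N₁) (W' : Bordism N₁ N₂)

/-- The end of the first and the beginning of the second bordism, as collars in the disjoint
union. -/
def middleCollars :
    TwoCollars N₁ (W.toCompactOrientedManifold.sum W'.toCompactOrientedManifold) where
  left := Sum.inl ∘ W.collar₁
  right := Sum.inr ∘ W'.collar₀
  isOpenEmbedding :=
    (Topology.IsOpenEmbedding.inl.comp W.isOpenEmbedding_collar₁).sumElim
      (Topology.IsOpenEmbedding.inr.comp W'.isOpenEmbedding_collar₀) <|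
      (Sum.inl_injective.comp W.collar₁_injective).sumElim
        (Sum.inr_injective.comp W'.collar₀_injective) fun _ _ => Sum.inl_ne_inr

theorem isOriented_middleCollars :
    (W.middleCollars W').IsOriented (𝓡 p) ((𝓡 p).prod (𝓡∂ 1)) N₁.orientation
      (W.toCompactOrientedManifold.sum W'.toCompactOrientedManifold).orientation where
  left z := (OrientedLocalDiffeoAt.inl W.orientation W'.orientation _).comp (W.oriented₁ z)
  right z := (OrientedLocalDiffeoAt.inr W.orientation W'.orientation _).comp (W'.oriented₀ z)

theorem inl_collar₀_notMem_range_left (z : N₀ × EuclideanHalfSpace 1) :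
    Sum.inl (W.collar₀ z) ∉ Set.range (W.middleCollars W').left := by
  rintro ⟨z', h⟩
  exact W.collar₀_ne_collar₁ z z' (Sum.inl_injective h).symm

theorem inl_notMem_range_right (v : W.carrier) :
    Sum.inl v ∉ Set.range (W.middleCollars W').right := fun ⟨_, h⟩ => Sum.inr_ne_inl h

theorem inr_notMem_range_left (v : W'.carrier) :
    Sum.inr v ∉ Set.range (W.middleCollars W').left := fun ⟨_, h⟩ => Sum.inl_ne_inr h

theorem inr_collar₁_notMem_range_right (z : N₂ × EuclideanHalfSpace 1) :
    Sum.inr (W'.collar₁ z) ∉ Set.range (W.middleCollars W').right := by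
  rintro ⟨z', h⟩
  exact W'.collar₀_ne_collar₁ z' z (Sum.inr_injective h)

/-- The first collar of the composed bordism. -/
noncomputable def transCollar₀ (z : N₀ × EuclideanHalfSpace 1) : (W.middleCollars W').Glued :=
  (W.middleCollars W').proj (Sum.inl (W.collar₀ z))

/-- The last collar of the composed bordism. -/
noncomputable def transCollar₁ (z : N₂ × EuclideanHalfSpace 1) : (W.middleCollars W').Glued :=
  (W.middleCollars W').proj (Sum.inr (W'.collar₁ z))

theorem transCollars_injective :
    Function.Injective (Sum.elim (W.transCollar₀ W') (W.transCollar₁ W')) := by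
  have hinl (z v) (h : W.transCollar₀ W' z = (W.middleCollars W').proj v) :
      Sum.inl (W.collar₀ z) = v :=
    TwoCollars.eq_of_proj_eq_of_notMem_range h (W.inl_collar₀_notMem_range_left W' z)
      (W.inl_notMem_range_right W' _)
  have hinr (z v) (h : W.transCollar₁ W' z = (W.middleCollars W').proj v) :
      Sum.inr (W'.collar₁ z) = v :=
    TwoCollars.eq_of_proj_eq_of_notMem_range h (W.inr_notMem_range_left W' _)
      (W.inr_collar₁_notMem_range_right W' z)
  refine Function.Injective.sumElim (fun z z' h => ?_) (fun z z' h => ?_) fun z z' h => ?_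
  · exact W.collar₀_injective (Sum.inl_injective (hinl z _ h))
  · exact W'.collar₁_injective (Sum.inr_injective (hinr z _ h))
  · exact Sum.inl_ne_inr (hinl z _ h)

theorem mem_boundary_sum_iff {v : W.carrier ⊕ W'.carrier} :
    v ∈ ((𝓡 p).prod (𝓡∂ 1)).boundary (W.carrier ⊕ W'.carrier) ↔
      ((∃ x, Sum.inl (W.end₀ x) = v) ∨ ∃ x, Sum.inl (W.end₁ x) = v) ∨
        (∃ x, Sum.inr (W'.end₀ x) = v) ∨ ∃ x, Sum.inr (W'.end₁ x) = v := by
  rw [ModelWithCorners.boundary_disjointUnion, W.boundary_eq, W'.boundary_eq, Set.image_union,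
    Set.image_union, ← Set.range_comp, ← Set.range_comp, ← Set.range_comp, ← Set.range_comp]
  rfl

theorem boundary_gluedManifold_middleCollars :
    ((𝓡 p).prod (𝓡∂ 1)).boundary
        (TwoCollars.gluedManifold (W.isOriented_middleCollars W')) =
      Set.range (fun x => W.transCollar₀ W' (x, 0)) ∪
        Set.range (fun x => W.transCollar₁ W' (x, 0)) := by
  have hP := (W.isOriented_middleCollars W').isOrientedQuotient
  ext q
  refine (hP.mem_boundary_iff_rep q).trans ((W.mem_boundary_sum_iff W').trans ⟨?_, ?_⟩)
  · rintro ((⟨x, hx⟩ | ⟨x, hx⟩) | ⟨x, hx⟩ | ⟨x, hx⟩)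
    · exact Or.inl ⟨x, (congrArg _ hx).trans (hP.apply_rep q)⟩
    · exact (hP.rep_mem q (Or.inl ⟨x, hx⟩)).elim
    · exact (hP.rep_mem q (Or.inr ⟨x, hx⟩)).elim
    · exact Or.inr ⟨x, (congrArg _ hx).trans (hP.apply_rep q)⟩
  · rintro (⟨x, rfl⟩ | ⟨x, rfl⟩)
    · exact Or.inl (Or.inl ⟨x, (TwoCollars.rep_proj_of_notMem_range
        (W.isOriented_middleCollars W')
        (W.inl_collar₀_notMem_range_left W' _) (W.inl_notMem_range_right W' _)).symm⟩)
    · exact Or.inr (Or.inr ⟨x, (TwoCollars.rep_proj_of_notMem_range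
        (W.isOriented_middleCollars W')
        (W.inr_notMem_range_left W' _) (W.inr_collar₁_notMem_range_right W' _)).symm⟩)

/-- The composition of two bordisms. -/
noncomputable def trans : Bordism N₀ N₂ where
  toCompactOrientedManifold := TwoCollars.gluedManifold (W.isOriented_middleCollars W')
  collar₀ := W.transCollar₀ W'
  collar₁ := W.transCollar₁ W'
  oriented₀ z := TwoCollars.oriented_proj_comp _ (W.inl_collar₀_notMem_range_left W' z)
    (W.inl_notMem_range_right W' _)
    ((OrientedLocalDiffeoAt.inl W.orientation W'.orientation _).comp (W.oriented₀ z))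
  oriented₁ z := TwoCollars.oriented_proj_comp _ (W.inr_notMem_range_left W' _)
    (W.inr_collar₁_notMem_range_right W' z)
    ((OrientedLocalDiffeoAt.inr W.orientation W'.orientation _).comp (W'.oriented₁ z))
  injective := W.transCollars_injective W'
  boundary_eq := W.boundary_gluedManifold_middleCollars W'

end Trans

/-- The bordism read backwards. -/
noncomputable def symm (W : Bordism N₀ N₁) : Bordism N₁ N₀ where
  toCompactOrientedManifold := W.toCompactOrientedManifold.neg
  collar₀ := W.collar₁
  collar₁ := W.collar₀
  oriented₀ z := (W.oriented₁ z).congr_orientation (by simp [CompactOrientedManifold.neg])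
  oriented₁ z := (W.oriented₀ z).congr_orientation (by simp [CompactOrientedManifold.neg])
  injective := W.collar₁_injective.sumElim W.collar₀_injective fun z z' =>
    (W.collar₀_ne_collar₁ z' z).symm
  boundary_eq := W.boundary_eq.trans (Set.union_comm _ _)

end Bordism

namespace Bordant
variable {p : ℕ} {A B : Type*} [TopologicalSpace A] [TopologicalSpace B]
  {s t r : SingularClosedManifold p A}

theorem symm : Bordant s t → Bordant t s := by
  rintro ⟨W, h, h₀, h₁⟩
  exact ⟨W.symm, h, h₁, h₀⟩

theorem trans : Bordant s t → Bordant t r → Bordant s r := by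
  rintro ⟨W, h, h₀, h₁⟩ ⟨W', h', h₀', h₁'⟩
  let k : C(W.carrier ⊕ W'.carrier, A) := ⟨Sum.elim h h', h.continuous.sumElim h'.continuous⟩
  refine ⟨W.trans W', (W.middleCollars W').descend k fun x => (h₁ x).trans (h₀' x).symm,
    fun x => ?_, fun x => ?_⟩
  · exact (congrArg k ((W.middleCollars W').collapseMap_of_notMem_range
      (W.inl_collar₀_notMem_range_left W' _) (W.inl_notMem_range_right W' _))).trans (h₀ x)
  · exact (congrArg k ((W.middleCollars W').collapseMap_of_notMem_range
      (W.inr_notMem_range_left W' _) (W.inr_collar₁_notMem_range_right W' _))).trans (h₁' x)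

theorem equivalence : Equivalence (Bordant (p := p) (A := A)) :=
  ⟨IsAdditiveRelation.bordant.refl, symm, trans⟩

theorem push (e : C(A, B)) : Bordant s t → Bordant (s.push e) (t.push e) := by
  rintro ⟨W, h, h₀, h₁⟩
  exact ⟨W, e.comp h, fun x => congrArg e (h₀ x), fun x => congrArg e (h₁ x)⟩

end Bordant

section InducedHom
variable {X U V Z : Type*} [TopologicalSpace X] [TopologicalSpace U] [TopologicalSpace V]
  [TopologicalSpace Z] {p : ℕ} {Y : Set Z}

theorem nielsenClass_eq_iff {f : C(X, Z)} {s t : SingularClosedManifold p (f ⁻¹' Y)} :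
    nielsenClass s = nielsenClass t ↔
      Bordant (s.push (toHomotopyFiber f Y)) (t.push (toHomotopyFiber f Y)) := by
  have h : Equivalence (NielsenEquiv (p := p) f Y) := by
    have hiff : NielsenEquiv (p := p) f Y = _ :=
      funext₂ fun s t => propext (nielsenEquiv_iff f Y s t)
    exact hiff ▸ Bordant.equivalence.comap (SingularClosedManifold.push (toHomotopyFiber f Y))
  exact (Quot.eq.trans h.eqvGen_iff).trans (nielsenEquiv_iff f Y s t)

theorem inducedHom_comp_apply {f : C(X, Z)} {g : C(U, Z)} {e : C(V, Z)} {k : C(X, U)}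
    {l : C(U, V)} {m : C(X, V)} (hk : g.comp k = f) (hl : e.comp l = g) (hm : e.comp m = f)
    (h : l.comp k = m) (z : PreNielsenGroup f Y p) :
    inducedHom l hl Y p (inducedHom k hk Y p z) = inducedHom m hm Y p z := by
  subst h
  obtain ⟨s⟩ := z
  rfl

theorem inducedHom_id_apply {f : C(X, Z)} {k : C(X, X)} (hk : f.comp k = f)
    (h : k = ContinuousMap.id X) (z : PreNielsenGroup f Y p) : inducedHom k hk Y p z = z := by
  subst h
  obtain ⟨s⟩ := z
  rfl

end InducedHom

namespace HomotopyFiber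
variable {X U Z A : Type*} [TopologicalSpace X] [TopologicalSpace U] [TopologicalSpace Z]
  [TopologicalSpace A] {Y : Set Z}

/-- The projection of the homotopy fiber to the source of the map. -/
def source (f : C(X, Z)) (Y : Set Z) : C(HomotopyFiber f Y, X) where
  toFun q := q.1.1
  continuous_toFun := continuous_fst.comp continuous_subtype_val

/-- The projection of the homotopy fiber to the subspace `Y`. -/
def target (f : C(X, Z)) (Y : Set Z) : C(HomotopyFiber f Y, Y) where
  toFun q := q.1.2.2
  continuous_toFun := (continuous_snd.comp continuous_snd).comp continuous_subtype_val

/-- The universal homotopy `(t, (x, γ, y)) ↦ γ t`. -/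
def homotopy (f : C(X, Z)) (Y : Set Z) :
    (f.comp (source f Y)).Homotopy ((ContinuousMap.mk Subtype.val).comp (target f Y)) where
  toFun z := z.2.1.2.1 z.1
  continuous_toFun := ContinuousEval.continuous_eval.comp
    ((((continuous_fst.comp continuous_snd).comp continuous_subtype_val).comp
      continuous_snd).prodMk continuous_fst)
  map_zero_left q := q.2.1
  map_one_left q := q.2.2

/-- The map to the homotopy fiber with given components. -/
def lift {f : C(X, Z)} {x : C(A, X)} {y : C(A, Y)}
    (h : (f.comp x).Homotopy ((ContinuousMap.mk Subtype.val).comp y)) :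
    C(A, HomotopyFiber f Y) where
  toFun a := ⟨(x a, (h.toContinuousMap.comp ContinuousMap.prodSwap).curry a, y a),
    h.map_zero_left a, h.map_one_left a⟩
  continuous_toFun := Continuous.subtype_mk (x.continuous.prodMk
    ((h.toContinuousMap.comp ContinuousMap.prodSwap).curry.continuous.prodMk y.continuous)) _

end HomotopyFiber

section Retraction
variable {X U Z : Type*} [TopologicalSpace X] [TopologicalSpace U] [TopologicalSpace Z]
  {p : ℕ} {Y : Set Z} {f : C(X, Z)} {g : C(U, Z)} {k : C(X, U)}

theorem inducedHom_injective_of_homotopyFiber_retraction (hk : g.comp k = f)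
    (R : C(HomotopyFiber g Y, HomotopyFiber f Y))
    (hR : (R.comp (toHomotopyFiber g Y)).comp (preimageMap k hk Y) = toHomotopyFiber f Y) :
    Function.Injective (inducedHom k hk Y p) := by
  rintro ⟨s⟩ ⟨t⟩ hst
  have hbordant := (nielsenClass_eq_iff.1 hst).push R
  refine nielsenClass_eq_iff.2 ?_
  rw [← hR]
  exact hbordant

/-- A triple `(u, γ, y)` is retracted to `(r u, δ * γ, y)`, where `δ` is the image of the track of
`u`, which leads from `k (r u)` to `u` and is constant for `u` in the image of `k`. -/
theorem inducedHom_injective_of_strongDeformationRetract (hk : g.comp k = f) {r : C(U, X)}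
    (hr : r.comp k = ContinuousMap.id X)
    (M : (k.comp r).HomotopyRel (ContinuousMap.id U) (Set.range k)) :
    Function.Injective (inducedHom k hk Y p) := by
  subst hk
  let track : (g.comp (k.comp r)).Homotopy g := (ContinuousMap.Homotopy.refl g).comp M.toHomotopy
  let R := HomotopyFiber.lift (f := g.comp k) (x := r.comp (HomotopyFiber.source g Y))
    ((track.compContinuousMap (HomotopyFiber.source g Y)).trans (HomotopyFiber.homotopy g Y))
  refine inducedHom_injective_of_homotopyFiber_retraction rfl R ?_
  ext1 x
  refine Subtype.ext (Prod.ext (DFunLike.congr_fun hr x.1)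
    (Prod.ext (ContinuousMap.ext fun t => ?_) rfl))
  refine (ContinuousMap.Homotopy.trans_apply _ _ _).trans ?_
  split_ifs
  · exact congrArg g (M.eq_snd _ ⟨x.1, rfl⟩)
  · rfl

end Retraction

section Cylinder
open unitInterval
variable {X Z A : Type*} [TopologicalSpace X] [TopologicalSpace Z] [TopologicalSpace A]
  {p : ℕ} {Y : Set Z}

/-- The straight-line homotopy from `φ` to the identity for a map `φ` of the cylinder `I × X` to
itself that preserves the second coordinate. -/
noncomputable def straightLineHomotopy (φ : C(I × X, I × X)) (hφ : ∀ u, (φ u).2 = u.2) :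
    φ.HomotopyRel (ContinuousMap.id (I × X)) {u | φ u = u} where
  toFun z := (⟨AffineMap.lineMap ((φ z.2).1 : ℝ) (z.2.1 : ℝ) (z.1 : ℝ),
    (convex_Icc 0 1).lineMap_mem (φ z.2).1.2 z.2.1.2 z.1.2⟩, z.2.2)
  continuous_toFun := by
    simp only [AffineMap.lineMap_apply_module]
    fun_prop
  map_zero_left u := Prod.ext (Subtype.ext (AffineMap.lineMap_apply_zero _ _)) (hφ u).symm
  map_one_left u := Prod.ext (Subtype.ext (AffineMap.lineMap_apply_one _ _)) rfl
  prop' t u hu := by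
    have hu : φ u = u := hu
    refine Prod.ext (Subtype.ext ?_) (hφ u).symm
    change AffineMap.lineMap ((φ u).1 : ℝ) (u.1 : ℝ) (t : ℝ) = ((φ u).1 : ℝ)
    rw [hu, AffineMap.lineMap_same_apply]

theorem inducedHom_injective_of_cylinder_retraction {F : C(I × X, Z)} {f : C(A, Z)}
    {k : C(A, I × X)} (hk : F.comp k = f) (r : C(I × X, A))
    (hr : r.comp k = ContinuousMap.id A) (hkr : ∀ u, (k (r u)).2 = u.2) :
    Function.Injective (inducedHom k hk Y p) := by
  refine inducedHom_injective_of_strongDeformationRetract hk hr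
    ⟨(straightLineHomotopy (k.comp r) hkr).toHomotopy, fun t u hu => ?_⟩
  obtain ⟨a, rfl⟩ := hu
  exact (straightLineHomotopy (k.comp r) hkr).eq_fst t (congrArg k (DFunLike.congr_fun hr a))

theorem inducedHom_slice_injective {F : C(I × X, Z)} {f : C(X, Z)} {t : I}
    (hF : F.comp (slice X t) = f) : Function.Injective (inducedHom (slice X t) hF Y p) :=
  inducedHom_injective_of_cylinder_retraction hF ContinuousMap.snd rfl fun _ => rfl

/-- `(t, x) ↦ (t / 2, x)`. -/
noncomputable def lowerHalf (X : Type*) [TopologicalSpace X] : C(I × X, I × X) where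
  toFun z := (⟨z.1 / 2, unitInterval.div_mem z.1.2.1 zero_le_two (z.1.2.2.trans one_le_two)⟩, z.2)

/-- `(t, x) ↦ ((1 + t) / 2, x)`. -/
noncomputable def upperHalf (X : Type*) [TopologicalSpace X] : C(I × X, I × X) where
  toFun z := (⟨(1 + z.1) / 2, unitInterval.div_mem (by linarith [z.1.2.1]) zero_le_two
    (by linarith [z.1.2.2])⟩, z.2)

theorem lowerHalf_comp_slice_zero : (lowerHalf X).comp (slice X 0) = slice X 0 :=
  ContinuousMap.ext fun _ => Prod.ext (Subtype.ext (zero_div 2)) rfl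

theorem lowerHalf_comp_slice_one :
    (lowerHalf X).comp (slice X 1) = (upperHalf X).comp (slice X 0) :=
  ContinuousMap.ext fun _ => Prod.ext
    (Subtype.ext (congrArg (· / 2) (add_zero (1 : ℝ)).symm)) rfl

theorem upperHalf_comp_slice_one : (upperHalf X).comp (slice X 1) = slice X 1 :=
  ContinuousMap.ext fun _ => Prod.ext (Subtype.ext (add_self_div_two (1 : ℝ))) rfl

theorem inducedHom_upperHalf_injective {F G : C(I × X, Z)} (hF : F.comp (upperHalf X) = G) :
    Function.Injective (inducedHom (upperHalf X) hF Y p) := by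
  let r : C(I × X, I × X) :=
    ⟨fun z => (Set.projIcc 0 1 zero_le_one (2 * (z.1 : ℝ) - 1), z.2),
      (continuous_projIcc.comp (by fun_prop)).prodMk continuous_snd⟩
  refine inducedHom_injective_of_cylinder_retraction hF r (ContinuousMap.ext fun z => ?_)
    fun _ => rfl
  have hz : 2 * ((1 + (z.1 : ℝ)) / 2) - 1 = z.1 := by ring
  exact Prod.ext ((congrArg _ hz).trans (Set.projIcc_val zero_le_one z.1)) rfl

variable {f₀ f₁ f₂ : C(X, Z)}

theorem homotopy_comp_slice_zero (F : f₀.Homotopy f₁) : F.toContinuousMap.comp (slice X 0) = f₀ :=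
  ContinuousMap.ext F.apply_zero

theorem homotopy_comp_slice_one (F : f₀.Homotopy f₁) : F.toContinuousMap.comp (slice X 1) = f₁ :=
  ContinuousMap.ext F.apply_one

theorem homotopy_trans_comp_lowerHalf (F : f₀.Homotopy f₁) (G : f₁.Homotopy f₂) :
    (F.trans G).toContinuousMap.comp (lowerHalf X) = F.toContinuousMap := by
  ext ⟨t, x⟩
  have ht : (t : ℝ) / 2 ≤ 1 / 2 := by linarith [t.2.2]
  refine (F.trans_apply G _).trans ((dif_pos ht).trans (F.congr_arg ?_))
  exact Prod.ext (Subtype.ext (mul_div_cancel₀ (t : ℝ) two_ne_zero)) rfl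

theorem homotopy_trans_comp_upperHalf (F : f₀.Homotopy f₁) (G : f₁.Homotopy f₂) :
    (F.trans G).toContinuousMap.comp (upperHalf X) = G.toContinuousMap := by
  ext ⟨t, x⟩
  refine (F.trans_apply G _).trans ?_
  rcases t.2.1.eq_or_lt with ht | ht
  · obtain rfl : t = 0 := Subtype.ext ht.symm
    have hhalf : (1 + ((0 : I) : ℝ)) / 2 ≤ 1 / 2 := by norm_num
    have hone : 2 * ((1 + ((0 : I) : ℝ)) / 2) = 1 := by norm_num
    refine (dif_pos hhalf).trans (Eq.trans (b := F (1, x)) (F.congr_arg ?_)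
      ((F.apply_one x).trans (G.apply_zero x).symm))
    exact Prod.ext (Subtype.ext hone) rfl
  · have hhalf : ¬(1 + (t : ℝ)) / 2 ≤ 1 / 2 := by linarith
    refine (dif_neg hhalf).trans (G.congr_arg (Prod.ext (Subtype.ext ?_) rfl))
    change 2 * ((1 + (t : ℝ)) / 2) - 1 = t
    ring

end Cylinder

section NielsenGroup
variable {X U V Z : Type*} [TopologicalSpace X] [TopologicalSpace U] [TopologicalSpace V]
  [TopologicalSpace Z] {p : ℕ} {Y : Set Z}

theorem mem_nielsenSubgroup {f : C(X, Z)} {z : PreNielsenGroup f Y p} :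
    z ∈ nielsenSubgroup f Y p ↔ ∀ (f₁ : C(X, Z)) (F : f.Homotopy f₁),
      ∃ w : PreNielsenGroup f₁ Y p,
        inducedHom (slice X 1) (homotopy_comp_slice_one F) Y p w =
          inducedHom (slice X 0) (homotopy_comp_slice_zero F) Y p z := by
  simp only [nielsenSubgroup, AddSubgroup.mem_iInf, AddSubgroup.mem_comap, AddMonoidHom.mem_range]
  refine ⟨fun h f₁ F => ?_, fun h F hF => ?_⟩
  · obtain ⟨G, h₀, h₁⟩ := F
    obtain rfl : G.comp (slice X 1) = f₁ := ContinuousMap.ext h₁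
    exact h G (ContinuousMap.ext h₀)
  · exact h _ ⟨F, DFunLike.congr_fun hF, fun _ => rfl⟩

theorem inducedHom_mem_nielsenSubgroup {f : C(X, Z)} {g : C(U, Z)} {k : C(X, U)}
    (hk : g.comp k = f) {z : PreNielsenGroup f Y p} (hz : z ∈ nielsenSubgroup f Y p) :
    inducedHom k hk Y p z ∈ nielsenSubgroup g Y p := by
  subst hk
  rw [mem_nielsenSubgroup] at hz ⊢
  intro g₁ G
  obtain ⟨w, hw⟩ := hz _ (G.compContinuousMap k)
  let j : C(unitInterval × X, unitInterval × U) := (ContinuousMap.id unitInterval).prodMap k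
  have hj : G.toContinuousMap.comp j = (G.compContinuousMap k).toContinuousMap := rfl
  refine ⟨inducedHom k rfl Y p w, ?_⟩
  have h₀ : G.toContinuousMap.comp ((slice U 0).comp k) = g.comp k :=
    homotopy_comp_slice_zero (G.compContinuousMap k)
  have h₁ : G.toContinuousMap.comp ((slice U 1).comp k) = g₁.comp k :=
    homotopy_comp_slice_one (G.compContinuousMap k)
  rw [inducedHom_comp_apply _ _ h₁ rfl, inducedHom_comp_apply _ _ h₀ rfl,
    ← inducedHom_comp_apply (homotopy_comp_slice_one (G.compContinuousMap k)) hj h₁ rfl, hw,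
    inducedHom_comp_apply _ hj h₀ rfl]

/-- The homomorphism `S_p(f, Y) → S_p(g, Y)` induced by `k` with `g k = f`. -/
noncomputable def nielsenHom {f : C(X, Z)} {g : C(U, Z)} (k : C(X, U)) (hk : g.comp k = f)
    (Y : Set Z) (p : ℕ) : nielsenSubgroup f Y p →+ nielsenSubgroup g Y p :=
  ((inducedHom k hk Y p).comp (nielsenSubgroup f Y p).subtype).codRestrict _
    fun z => inducedHom_mem_nielsenSubgroup hk z.2

theorem nielsenHom_comp {f : C(X, Z)} {g : C(U, Z)} {e : C(V, Z)} {k : C(X, U)} {l : C(U, V)}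
    (hk : g.comp k = f) (hl : e.comp l = g) (hlk : e.comp (l.comp k) = f) :
    nielsenHom l hl Y p ∘ nielsenHom k hk Y p = nielsenHom (l.comp k) hlk Y p :=
  funext fun z => Subtype.ext (inducedHom_comp_apply hk hl hlk rfl z.1)

end NielsenGroup

section HomotopicToId
variable {U Z : Type*} [TopologicalSpace U] [TopologicalSpace Z] {p : ℕ} {Y : Set Z}
  {f g : C(U, Z)} {m : C(U, U)}

/-- The homotopy `g K : g m ≃ g` preserves a class `a` of the kernel: `a` corresponds to a class `b`
of `g`, and composition with `K` shows that `b` is the image of `a`, hence zero. -/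
theorem nielsenHom_injective_of_homotopic_id (hm : g.comp m = f)
    (h : m.Homotopic (ContinuousMap.id U)) : Function.Injective (nielsenHom m hm Y p) := by
  subst hm
  obtain ⟨K⟩ := h
  let F : (g.comp m).Homotopy g := (ContinuousMap.Homotopy.refl g).comp K
  have hF : g.comp K.toContinuousMap = F.toContinuousMap := rfl
  rw [injective_iff_map_eq_zero]
  rintro ⟨a, ha⟩ ha_zero
  have ha_zero : inducedHom m rfl Y p a = 0 := congrArg Subtype.val ha_zero
  obtain ⟨b, hb⟩ := mem_nielsenSubgroup.1 ha g F
  have hb_zero : b = 0 := by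
    have hK := congrArg (inducedHom K.toContinuousMap hF Y p) hb
    rwa [inducedHom_comp_apply _ _ (ContinuousMap.comp_id g) (homotopy_comp_slice_one K),
      inducedHom_id_apply _ rfl,
      inducedHom_comp_apply _ _ rfl (homotopy_comp_slice_zero K), ha_zero] at hK
  rw [hb_zero, map_zero] at hb
  exact Subtype.ext (inducedHom_slice_injective _ (hb.symm.trans (map_zero _).symm))

/-- Preservation of `w` by the concatenation of `F` with an arbitrary homotopy `H` yields
preservation of `v` by `H`, because the upper half of the cylinder is a retract. -/
theorem mem_nielsenSubgroup_of_homotopy (F : g.Homotopy f) {w : PreNielsenGroup g Y p}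
    (hw : w ∈ nielsenSubgroup g Y p) {v : PreNielsenGroup f Y p}
    (hvw : inducedHom (slice U 1) (homotopy_comp_slice_one F) Y p v =
      inducedHom (slice U 0) (homotopy_comp_slice_zero F) Y p w) :
    v ∈ nielsenSubgroup f Y p := by
  rw [mem_nielsenSubgroup] at hw ⊢
  intro f₁ H
  obtain ⟨a, ha⟩ := hw f₁ (F.trans H)
  refine ⟨a, inducedHom_upperHalf_injective (homotopy_trans_comp_upperHalf F H) ?_⟩
  have h₀ := homotopy_comp_slice_zero (F.trans H)
  have h₁ := homotopy_comp_slice_one (F.trans H)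
  have hmid : (F.trans H).toContinuousMap.comp ((upperHalf U).comp (slice U 0)) = f := by
    rw [← ContinuousMap.comp_assoc, homotopy_trans_comp_upperHalf, homotopy_comp_slice_zero]
  rw [inducedHom_comp_apply _ _ h₁ upperHalf_comp_slice_one, ha,
    inducedHom_comp_apply _ _ hmid rfl,
    ← inducedHom_comp_apply (homotopy_comp_slice_one F) (homotopy_trans_comp_lowerHalf F H) hmid
      lowerHalf_comp_slice_one,
    hvw, inducedHom_comp_apply _ _ h₀ lowerHalf_comp_slice_zero]

theorem nielsenHom_surjective_of_homotopic_id (hm : g.comp m = f)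
    (h : m.Homotopic (ContinuousMap.id U)) : Function.Surjective (nielsenHom m hm Y p) := by
  subst hm
  obtain ⟨K⟩ := h.symm
  let F : g.Homotopy (g.comp m) := (ContinuousMap.Homotopy.refl g).comp K
  have hF : g.comp K.toContinuousMap = F.toContinuousMap := rfl
  rintro ⟨w, hw⟩
  obtain ⟨v, hv⟩ := mem_nielsenSubgroup.1 hw _ F
  refine ⟨⟨v, mem_nielsenSubgroup_of_homotopy F hw hv⟩, Subtype.ext ?_⟩
  have hK := congrArg (inducedHom K.toContinuousMap hF Y p) hv
  rwa [inducedHom_comp_apply _ _ rfl (homotopy_comp_slice_one K),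
    inducedHom_comp_apply _ _ (ContinuousMap.comp_id g) (homotopy_comp_slice_zero K),
    inducedHom_id_apply _ rfl] at hK

theorem nielsenHom_bijective_of_homotopic_id (hm : g.comp m = f)
    (h : m.Homotopic (ContinuousMap.id U)) : Function.Bijective (nielsenHom m hm Y p) :=
  ⟨nielsenHom_injective_of_homotopic_id hm h, nielsenHom_surjective_of_homotopic_id hm h⟩

end HomotopicToId

section Functoriality
variable {X U Z : Type*} [TopologicalSpace X] [TopologicalSpace U] [TopologicalSpace Z]
  {p : ℕ} {Y : Set Z} {f : C(X, Z)} {g : C(U, Z)}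

/-- Two-out-of-six for `S_p(g k l k) → S_p(g k l) → S_p(g k) → S_p(g)`, where `l` is a homotopy
inverse of `k`. -/
theorem nielsenHom_bijective (e : ContinuousMap.HomotopyEquiv X U) (hk : g.comp e.toFun = f) :
    Function.Bijective (nielsenHom e.toFun hk Y p) := by
  subst hk
  obtain ⟨k, l, hlk, hkl⟩ := e
  let k₀ := nielsenHom (g := g) k rfl Y p
  let l₀ := nielsenHom (g := g.comp k) l rfl Y p
  let k₁ := nielsenHom (g := (g.comp k).comp l) k rfl Y p
  have hlk_bij : Function.Bijective (l₀ ∘ k₁) := by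
    rw [nielsenHom_comp rfl rfl rfl]
    exact nielsenHom_bijective_of_homotopic_id _ hlk
  have hkl_bij : Function.Bijective (k₀ ∘ l₀) := by
    rw [nielsenHom_comp rfl rfl rfl]
    exact nielsenHom_bijective_of_homotopic_id _ hkl
  have hl_bij : Function.Bijective l₀ := ⟨hkl_bij.injective.of_comp, hlk_bij.surjective.of_comp⟩
  exact (Function.Bijective.of_comp_iff k₀ hl_bij).1 hkl_bij

theorem bordismIndex_inducedHom {k : C(X, U)} (hk : g.comp k = f) (z : PreNielsenGroup f Y p) :
    bordismIndex g Y p (inducedHom k hk Y p z) = bordismIndex f Y p z := by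
  subst hk
  obtain ⟨s⟩ := z
  rfl

/-- The homomorphism `S^a_p(f, Y) → S^a_p(g, Y)` induced by `k` with `g k = f`. -/
noncomputable def algNielsenHom (k : C(X, U)) (hk : g.comp k = f) (Y : Set Z) (p : ℕ) :
    AlgNielsenGroup f Y p →+ AlgNielsenGroup g Y p :=
  QuotientAddGroup.map _ _ (inducedHom k hk Y p) fun z hz => by
    rw [AddSubgroup.mem_comap, AddMonoidHom.mem_ker, bordismIndex_inducedHom]
    exact hz

end Functoriality

section Functors
variable {Z : TopCat.{u}} (Y : Set Z)

/-- The functor `S'_*`. -/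
noncomputable def preNielsenFunctor : FunctorOn (preNielsenObj Y) where
  map k p := AddCommGrpCat.ofHom (inducedHom (morphismMap k) (problemMap_comp k) Y p)
  map_id P := by
    funext p
    ext z
    exact inducedHom_id_apply _ rfl z
  map_comp k l := by
    funext p
    ext z
    exact (inducedHom_comp_apply _ _ _ rfl z).symm

/-- The functor `S_*`. -/
noncomputable def nielsenFunctor : FunctorOn (nielsenObj Y) where
  map k p := AddCommGrpCat.ofHom (nielsenHom (morphismMap k) (problemMap_comp k) Y p)
  map_id P := by
    funext p
    ext z
    exact inducedHom_id_apply _ rfl z.1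
  map_comp k l := by
    funext p
    ext z
    exact (inducedHom_comp_apply _ _ _ rfl z.1).symm

/-- The functor `S^a_*`. -/
noncomputable def algNielsenFunctor : FunctorOn (algNielsenObj Y) where
  map k p := AddCommGrpCat.ofHom (algNielsenHom (morphismMap k) (problemMap_comp k) Y p)
  map_id P := by
    funext p
    ext z
    exact congrArg QuotientAddGroup.mk (inducedHom_id_apply _ rfl z)
  map_comp k l := by
    funext p
    ext z
    exact congrArg QuotientAddGroup.mk (inducedHom_comp_apply _ _ _ rfl z).symm

theorem isIso_nielsenFunctor_map {P Q : Over Z} (k : P ⟶ Q)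
    (e : ContinuousMap.HomotopyEquiv P.left Q.left) (he : e.toFun = morphismMap k) :
    IsIso ((nielsenFunctor Y).map k) := by
  refine (isIso_pi_iff _).2 fun p => (ConcreteCategory.isIso_iff_bijective _).2 ?_
  have hbij (m : C(P.left, Q.left)) (hm : (problemMap Q).comp m = problemMap P)
      (hem : e.toFun = m) : Function.Bijective (nielsenHom m hm Y p) := by
    subst hem
    exact nielsenHom_bijective e hm
  exact hbij _ (problemMap_comp k) he

end Functors

end HigherNielsen

theorem mainTheorem10 (Z : TopCat.{u}) (Y : Set Z) :
    ∃ (S' : FunctorOn (preNielsenObj Y)) (S : FunctorOn (nielsenObj Y))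
      (Sa : FunctorOn (algNielsenObj Y)),
      (∀ (P Q : Over Z) (k : P ⟶ Q) (p : ℕ)
        (s : SingularClosedManifold p (problemMap P ⁻¹' Y)),
        (S'.map k p).hom (nielsenClass s) =
          nielsenClass (s.push (preimageMap (morphismMap k) (problemMap_comp k) Y))) ∧
      (∀ (P Q : Over Z) (k : P ⟶ Q) (p : ℕ) (z : nielsenSubgroup (problemMap P) Y p),
        ((S.map k p).hom z : nielsenSubgroup (problemMap Q) Y p).1 = (S'.map k p).hom z.1) ∧
      (∀ (P Q : Over Z) (k : P ⟶ Q) (p : ℕ) (z : PreNielsenGroup (problemMap P) Y p),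
        (Sa.map k p).hom (QuotientAddGroup.mk z) =
          QuotientAddGroup.mk ((S'.map k p).hom z : PreNielsenGroup (problemMap Q) Y p)) ∧
      (∀ (P Q : Over Z) (k : P ⟶ Q),
        (∃ e : ContinuousMap.HomotopyEquiv P.left Q.left, e.toFun = morphismMap k) →
          IsIso (S.map k)) :=
  ⟨preNielsenFunctor Y, nielsenFunctor Y, algNielsenFunctor Y, fun _ _ _ _ _ => rfl,
    fun _ _ _ _ _ => rfl, fun _ _ _ _ _ => rfl,
    fun _ _ k ⟨e, he⟩ => isIso_nielsenFunctor_map Y k e he⟩
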